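/- Let $k\ge 1$ and let $n_1,\dots,n_k$ be positive integers with $n_1+\dots+n_k\ge 2$. Consider the $\beta$-stochastic blockmodel ($\beta$-SBM) $\mathcal M(n_1,\dots,n_k)$ with vertices $(i,v)$, $1\le i\le k$, $1\le v\le n_i$ (vertex $(i,v)$ lies in block $i$). Let $E$ be the set of dyads, i.e. of unordered pairs of distinct vertices, and let $A$ be the $0/1$ design matrix with columns indexed by $E$ and rows indexed by the vertices and by the unordered pairs of (possibly equal) blocks: the entry in the row of a vertex $x$ and the column $e$ is $1$ iff $x\in e$, and the entry in the row of $\{\ell_1,\ell_2\}$ and the column $\{(i,v),(j,w)\}$ is $1$ iff $\{\ell_1,\ell_2\}=\{i,j\}$. For $\mathbf u\in\mathbb C^{E}$ the likelihood equations of the model are the following equations in $\mathbf p=(p_e)_{e\in E}\in\mathbb C^{E}$: the linear equations $A(\mathbf p-\mathbf u)=\mathbf 0$ and the quadratic equations - (within block) $p_{(i,t)(i,u)}p_{(i,v)(i,w)}-p_{(i,t)(i,v)}p_{(i,u)(i,w)}=0$ for pairwise distinct $t,u,v,w$; - (3-1) $p_{(i,t)(j,w)}p_{(i,u)(i,v)}-p_{(i,t)(i,u)}p_{(i,v)(j,w)}=0$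 for $i\ne j$ and pairwise distinct $t,u,v$; - (2-2) $p_{(i,t)(j,v)}p_{(i,u)(j,w)}-p_{(i,t)(j,w)}p_{(i,u)(j,v)}=0$ for $i\ne j$, $t\ne u$, $v\ne w$; - (2-1-1) $p_{(i,t)(j,v)}p_{(i,u)(l,w)}-p_{(i,t)(l,w)}p_{(i,u)(j,v)}=0$ for pairwise distinct $i,j,l$ and $t\ne u$. The maximum likelihood degree $\operatorname{MLdeg}(n_1,\dots,n_k)$ is the number of solutions $\mathbf p\in\mathbb C^{E}$ of the likelihood equations for generic $\mathbf u$, that is, the nonnegative integer $d$ for which there is a nonzero polynomial $f$ on $\mathbb C^{E}$ such that the equations have exactly $d$ solutions whenever $f(\mathbf u)\neq 0$. **Corollary (monotonicity).** Let $\mathcal M(m_1,\dots,m_j)$ and $\mathcal M(n_1,\dots,n_k)$ be $\beta$-SBMs. If $j\le k$ and $m_i\le n_i$ for all $1\le i\le j$, then both ML degrees are well defined and $$\operatorname{MLdeg}(m_1,\dots,m_j)\le \operatorname{MLdeg}(n_1,\dots,n_k).$$ In other words, adding blocks or adding vertices to blocks never decreases the ML degree. -/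

import Mathlib

namespace BetaSBM

/-- The vertices of the `β`-stochastic blockmodel with `k` blocks of sizes `n 0, …, n (k-1)`:
the pair `⟨i, v⟩` is the `v`-th vertex of the `i`-th block. -/
abbrev Vertex {k : ℕ} (n : Fin k → ℕ) : Type := Σ i : Fin k, Fin (n i)

/-- The dyads (potential edges): unordered pairs of distinct vertices. -/
abbrev Dyad {k : ℕ} (n : Fin k → ℕ) : Type := {e : Sym2 (Vertex n) // ¬ e.IsDiag}

/-- The design matrix. Its rows are indexed by the parameters `β_x` (`x` a vertex) and `α_b`
(`b` an unordered pair of blocks, possibly equal), its columns by the dyads. The `β_x` entry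
of the column `e` is `1` if `x` is an endpoint of `e`, the `α_b` entry is `1` if `b` is the
pair of blocks of the endpoints of `e`, and all other entries are `0`. -/
def designMatrix {k : ℕ} (n : Fin k → ℕ) :
    Matrix (Vertex n ⊕ Sym2 (Fin k)) (Dyad n) ℂ :=
  Matrix.of fun r e =>
    match r with
    | Sum.inl x => if x ∈ e.1 then 1 else 0
    | Sum.inr b => if e.1.map Sigma.fst = b then 1 else 0

/-- The coordinate `p_{ab}` of a point `p ∈ ℂ^E` at the dyad `{a, b}`, for vertices `a ≠ b`
(it is only ever used at distinct vertices; the value for `a = b` is irrelevant). -/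
def coord {k : ℕ} {n : Fin k → ℕ} (p : Dyad n → ℂ) (a b : Vertex n) : ℂ :=
  if h : a = b then 0 else p ⟨s(a, b), fun hd => h (Sym2.mk_isDiag_iff.mp hd)⟩

/-- The "within block" quadratic equations, on four distinct vertices of one block. -/
def WithinBlockEqs {k : ℕ} {n : Fin k → ℕ} (p : Dyad n → ℂ) : Prop :=
  ∀ (i : Fin k) (t u v w : Fin (n i)),
    t ≠ u → t ≠ v → t ≠ w → u ≠ v → u ≠ w → v ≠ w →
    coord p ⟨i, t⟩ ⟨i, u⟩ * coord p ⟨i, v⟩ ⟨i, w⟩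
      - coord p ⟨i, t⟩ ⟨i, v⟩ * coord p ⟨i, u⟩ ⟨i, w⟩ = 0

/-- The "3-1" quadratic equations, on three vertices of one block and one of another block. -/
def ThreeOneEqs {k : ℕ} {n : Fin k → ℕ} (p : Dyad n → ℂ) : Prop :=
  ∀ (i j : Fin k), i ≠ j → ∀ (t u v : Fin (n i)) (w : Fin (n j)),
    t ≠ u → t ≠ v → u ≠ v →
    coord p ⟨i, t⟩ ⟨j, w⟩ * coord p ⟨i, u⟩ ⟨i, v⟩
      - coord p ⟨i, t⟩ ⟨i, u⟩ * coord p ⟨i, v⟩ ⟨j, w⟩ = 0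

/-- The "2-2" quadratic equations, on two vertices of one block and two of another block. -/
def TwoTwoEqs {k : ℕ} {n : Fin k → ℕ} (p : Dyad n → ℂ) : Prop :=
  ∀ (i j : Fin k), i ≠ j → ∀ (t u : Fin (n i)) (v w : Fin (n j)),
    t ≠ u → v ≠ w →
    coord p ⟨i, t⟩ ⟨j, v⟩ * coord p ⟨i, u⟩ ⟨j, w⟩
      - coord p ⟨i, t⟩ ⟨j, w⟩ * coord p ⟨i, u⟩ ⟨j, v⟩ = 0

/-- The "2-1-1" quadratic equations, on two vertices of one block and one vertex of each of
two further blocks. -/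
def TwoOneOneEqs {k : ℕ} {n : Fin k → ℕ} (p : Dyad n → ℂ) : Prop :=
  ∀ (i j l : Fin k), i ≠ j → i ≠ l → j ≠ l →
    ∀ (t u : Fin (n i)) (v : Fin (n j)) (w : Fin (n l)), t ≠ u →
    coord p ⟨i, t⟩ ⟨j, v⟩ * coord p ⟨i, u⟩ ⟨l, w⟩
      - coord p ⟨i, t⟩ ⟨l, w⟩ * coord p ⟨i, u⟩ ⟨j, v⟩ = 0

/-- The complex solutions `p` of the likelihood equations with data `u`: the linear equations
`A (p - u) = 0` together with the four families of quadratic equations. -/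
def likelihoodSolutions {k : ℕ} (n : Fin k → ℕ) (u : Dyad n → ℂ) : Set (Dyad n → ℂ) :=
  {p | (designMatrix n).mulVec (p - u) = 0 ∧
    WithinBlockEqs p ∧ ThreeOneEqs p ∧ TwoTwoEqs p ∧ TwoOneOneEqs p}

/-- `d` is the number of complex solutions of the likelihood equations for generic data `u`,
that is, for all `u ∈ ℂ^E` off the zero set of some nonzero polynomial. -/
def IsMLDegree {k : ℕ} (n : Fin k → ℕ) (d : ℕ) : Prop :=
  ∃ f : MvPolynomial (Dyad n) ℂ, f ≠ 0 ∧
    ∀ u : Dyad n → ℂ, MvPolynomial.eval u f ≠ 0 →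
      (likelihoodSolutions n u).encard = (d : ℕ∞)

/-- The generic number of solutions is unique. -/
theorem IsMLDegree.unique {k : ℕ} {n : Fin k → ℕ} {d e : ℕ}
    (hd : IsMLDegree n d) (he : IsMLDegree n e) : d = e := by
  obtain ⟨f, hf, hfd⟩ := hd
  obtain ⟨g, hg, hge⟩ := he
  have hne : ∃ u : Dyad n → ℂ, MvPolynomial.eval u (f * g) ≠ 0 := by
    by_contra! h
    exact mul_ne_zero hf hg (MvPolynomial.funext fun u => by simpa using h u)
  obtain ⟨u, hu⟩ := hne
  rw [map_mul] at hu
  have h := (hfd u (left_ne_zero_of_mul hu)).symm.trans (hge u (right_ne_zero_of_mul hu))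
  exact_mod_cast h

/-- The maximum likelihood degree: the `d` with `IsMLDegree n d` (unique if it exists). -/
noncomputable def mlDegree {k : ℕ} (n : Fin k → ℕ) : ℕ := sInf {d | IsMLDegree n d}

/-- `mlDegree n` is the generic number of solutions as soon as there is one. -/
theorem IsMLDegree.mlDegree_eq {k : ℕ} {n : Fin k → ℕ} {d : ℕ} (hd : IsMLDegree n d) :
    mlDegree n = d :=
  (Nat.sInf_mem (s := {d | IsMLDegree n d}) ⟨d, hd⟩ : IsMLDegree n (mlDegree n)).unique hd

end BetaSBM

/-!
The likelihood equations make sense for every finite vertex set with a block map, and the proof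
works in this generality.

*The solutions are torus points.* The four families of quadrics say that exchanging two vertices
of the same block between two edges does not change the product of the coordinates (`SwapEqs`).
The support of a solution is therefore closed under such swaps. If no subsum of the data vanishes,
then the support meets every vertex, every pair of blocks, and the edges that meet a block outside
a given vertex of it, and a swap-closed graph with these properties is complete
(`adj_of_swap_closed`). A solution with nonzero coordinates has the form `exp (Aᵀ η)`
(`exists_eq_expPoint`).

*The ML degree is well defined.* Since `ℂ^E ≃ range Aᵀ × ker A`, the torus solutions for the data
`u` are the fibre over `u` of the map `(μ, κ) ↦ exp μ + κ` between spaces of the same dimension.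
By Sard's theorem, for almost all `u` the derivative is invertible along the fibre
(`ae_nondegenerate`), so that the fibre is discrete, hence countable (`ae_countable_expPoint`).
By Chevalley's theorem the set of `u` with at least `d` solutions contains or misses the complement
of a hypersurface (`exists_forall_le_encard_or_forall_lt_encard`). If it contained one for every
`d`, then almost all `u` would have infinitely many solutions; but a countable algebraic set is
finite (`finite_of_countable_zeros`).

*Monotonicity.* It suffices to add one vertex. A solution of the small model extends by zero to a
solution of the large one, for the data extended by zero. Around it there is a family of points of
the large model, the product of the torus of the small model and of an affine space that scales the
new edges (`newFamily`). Its tangent space is transverse to `ker A` at the extended solution if the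
solution is nondegenerate in the small model and if certain sums of exponentials do not vanish
(`range_newFamilyDeriv_sup_ker`). Both hold for almost all data; for the sums this is again Sard's
theorem, applied to a modification of the map above (`ae_sum_exp_ne_zero`). By the implicit function
theorem all the extended solutions persist for nearby data (`eventually_exists_solution`), among
which there are generic ones. Models with at most one edge have a single solution, and they are
treated separately, since the tangent space is then too small: every model has a generic solution,
because `p = 1` is a nondegenerate solution for the data `1` (`IsGenericCount.one_le`).
-/

open MeasureTheory MvPolynomial

namespace BetaSBM

/-! ### Polynomial zero sets -/

/-- A constructible subset of the spectrum of a domain contains, or misses, a nonempty basic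
open set. -/
theorem exists_basicOpen_subset_or_disjoint {R : Type*} [CommRing R] [IsDomain R]
    {s : Set (PrimeSpectrum R)} (hs : Topology.IsConstructible s) :
    ∃ f : R, f ≠ 0 ∧ ((∀ x : PrimeSpectrum R, f ∉ x.asIdeal → x ∈ s) ∨
      (∀ x : PrimeSpectrum R, f ∉ x.asIdeal → x ∉ s)) := by
  classical
  obtain ⟨S, rfl⟩ := PrimeSpectrum.exists_constructibleSetData_iff.mpr hs
  by_cases h : ∃ C ∈ S, C.f ≠ 0 ∧ ∀ i, C.g i = 0
  · obtain ⟨C, hC, hf, hg⟩ := h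
    refine ⟨C.f, hf, Or.inl fun x hx => ?_⟩
    simp only [PrimeSpectrum.ConstructibleSetData.toSet, Set.mem_iUnion]
    refine ⟨C, hC, ?_, ?_⟩
    · rintro _ ⟨i, rfl⟩
      simp [hg i]
    · simpa [PrimeSpectrum.mem_zeroLocus] using hx
  -- Otherwise every piece `V(g) \ V(f)` with `f ≠ 0` lies in a hypersurface `V(g i)`.
  · push Not at h
    choose i hi using h
    refine ⟨∏ C ∈ S.attach, if hC : C.1.f ≠ 0 then C.1.g (i C.1 C.2 hC) else 1, ?_, Or.inr ?_⟩
    · refine Finset.prod_ne_zero_iff.mpr fun C _ => ?_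
      split_ifs with hC
      · exact hi C.1 C.2 hC
      · exact one_ne_zero
    · intro x hx hmem
      simp only [PrimeSpectrum.ConstructibleSetData.toSet, Set.mem_iUnion] at hmem
      obtain ⟨C, hC, hg, hf⟩ := hmem
      have hC0 : C.f ≠ 0 := by
        intro h0
        apply hf
        simp [h0]
      refine hx (Ideal.mem_of_dvd _ (Finset.dvd_prod_of_mem _ (Finset.mem_attach S ⟨C, hC⟩)) ?_)
      rw [dif_pos hC0]
      exact hg ⟨_, rfl⟩

/-- Chevalley's theorem on complex points: a projection of an affine algebraic set contains, or
misses, the complement of a hypersurface. -/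
theorem exists_forall_exists_or_forall_not_exists {σ τ : Type*} [Finite σ] [Finite τ]
    (G : Set (MvPolynomial (σ ⊕ τ) ℂ)) :
    ∃ f : MvPolynomial σ ℂ, f ≠ 0 ∧
      ((∀ u, eval u f ≠ 0 → ∃ p : τ → ℂ, ∀ g ∈ G, eval (Sum.elim u p) g = 0) ∨
        (∀ u, eval u f ≠ 0 → ¬ ∃ p : τ → ℂ, ∀ g ∈ G, eval (Sum.elim u p) g = 0)) := by
  let φ : MvPolynomial σ ℂ →ₐ[ℂ] MvPolynomial (σ ⊕ τ) ℂ := rename Sum.inl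
  have hφ : (φ : MvPolynomial σ ℂ →+* MvPolynomial (σ ⊕ τ) ℂ).FinitePresentation := by
    apply RingHom.FinitePresentation.of_finiteType.mp
    refine RingHom.FiniteType.of_comp_finiteType (f := (C : ℂ →+* MvPolynomial σ ℂ)) ?_
    have h1 : (φ : MvPolynomial σ ℂ →+* MvPolynomial (σ ⊕ τ) ℂ).comp C = C := by
      ext
      simp [φ]
    rw [h1]
    exact RingHom.finiteType_algebraMap.mpr
      (inferInstance : Algebra.FiniteType ℂ (MvPolynomial (σ ⊕ τ) ℂ))
  have hcon : Topology.IsConstructible (PrimeSpectrum.zeroLocus G) := by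
    rw [← Topology.isConstructible_compl]
    have ho := (PrimeSpectrum.isClosed_zeroLocus G).isOpen_compl
    exact (TopologicalSpace.NoetherianSpace.isCompact _ : IsCompact _).isConstructible ho
  obtain ⟨f, hf0, hf⟩ := exists_basicOpen_subset_or_disjoint
    (PrimeSpectrum.isConstructible_comap_image hφ hcon)
  have key : ∀ u : σ → ℂ, (⟨vanishingIdeal ℂ {u}, inferInstance⟩ :
      PrimeSpectrum (MvPolynomial σ ℂ)) ∈ PrimeSpectrum.comap
        (φ : MvPolynomial σ ℂ →+* MvPolynomial (σ ⊕ τ) ℂ) '' PrimeSpectrum.zeroLocus G ↔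
      ∃ p : τ → ℂ, ∀ g ∈ G, eval (Sum.elim u p) g = 0 := by
    intro u
    constructor
    · rintro ⟨Q, hQ, hQu⟩
      obtain ⟨M, hM, hQM⟩ := Ideal.exists_le_maximal Q.asIdeal Q.2.ne_top
      obtain ⟨x, rfl⟩ := eq_vanishingIdeal_singleton_of_isMaximal (K := ℂ) hM
      have hx : ∀ i, x (Sum.inl i) = u i := by
        intro i
        have h1 : (X i - C (u i) : MvPolynomial σ ℂ) ∈ vanishingIdeal ℂ {u} := by
          rw [mem_vanishingIdeal_singleton_iff]
          simp
        have h2 : φ (X i - C (u i)) ∈ Q.asIdeal := by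
          have := congrArg PrimeSpectrum.asIdeal hQu
          simp only at this
          rw [← this] at h1
          exact h1
        have h3 := hQM h2
        rw [mem_vanishingIdeal_singleton_iff] at h3
        simpa [φ, sub_eq_zero] using h3
      refine ⟨fun j => x (Sum.inr j), fun g hg => ?_⟩
      have h4 := hQM (hQ hg)
      rw [mem_vanishingIdeal_singleton_iff] at h4
      have h5 : Sum.elim u (fun j => x (Sum.inr j)) = x := by
        ext (i | j) <;> simp [hx]
      rw [h5]
      simpa [aeval_eq_eval] using h4
    · rintro ⟨p, hp⟩
      refine ⟨⟨vanishingIdeal ℂ {Sum.elim u p}, inferInstance⟩, ?_, ?_⟩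
      · intro g hg
        change g ∈ vanishingIdeal ℂ {Sum.elim u p}
        rw [mem_vanishingIdeal_singleton_iff]
        simpa [aeval_eq_eval] using hp g hg
      · ext g
        change φ g ∈ vanishingIdeal ℂ {Sum.elim u p} ↔ g ∈ vanishingIdeal ℂ {u}
        rw [mem_vanishingIdeal_singleton_iff, mem_vanishingIdeal_singleton_iff]
        simp only [φ, aeval_rename, Sum.elim_comp_inl]
  have hmem : ∀ u : σ → ℂ, eval u f ≠ 0 → f ∉ vanishingIdeal ℂ {u} := by
    intro u hu h
    rw [mem_vanishingIdeal_singleton_iff] at h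
    exact hu (by simpa [aeval_eq_eval] using h)
  refine ⟨f, hf0, hf.imp (fun h u hu => ?_) (fun h u hu => ?_)⟩
  · exact (key u).mp (h _ (hmem u hu))
  · rw [← key u]
    exact h _ (hmem u hu)

/-- A countable complex affine algebraic set is finite: each coordinate takes either finitely
many values on it or all but finitely many. -/
theorem finite_of_countable_zeros {τ : Type*} [Finite τ] (G : Set (MvPolynomial τ ℂ))
    (hG : {p : τ → ℂ | ∀ g ∈ G, eval p g = 0}.Countable) :
    {p : τ → ℂ | ∀ g ∈ G, eval p g = 0}.Finite := by
  set Z := {p : τ → ℂ | ∀ g ∈ G, eval p g = 0}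
  have hcoord : ∀ e : τ, ((fun p : τ → ℂ => p e) '' Z).Finite := by
    intro e
    obtain ⟨f, hf0, hf⟩ := exists_forall_exists_or_forall_not_exists (σ := Unit) (τ := τ)
      ((rename Sum.inr : MvPolynomial τ ℂ →ₐ[ℂ] _) '' G ∪ {X (Sum.inr e) - X (Sum.inl ())})
    have key : ∀ c : Unit → ℂ, (∃ p : τ → ℂ, ∀ g ∈ (rename Sum.inr : MvPolynomial τ ℂ →ₐ[ℂ] _) '' G
        ∪ {X (Sum.inr e) - X (Sum.inl ())}, eval (Sum.elim c p) g = 0) ↔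
        c () ∈ (fun p : τ → ℂ => p e) '' Z := by
      intro c
      constructor
      · rintro ⟨p, hp⟩
        refine ⟨p, fun g hg => ?_, ?_⟩
        · simpa [eval_rename] using hp _ (Or.inl ⟨g, hg, rfl⟩)
        · simpa [sub_eq_zero] using hp _ (Or.inr rfl)
      · rintro ⟨p, hp, hpe⟩
        refine ⟨p, ?_⟩
        rintro _ (⟨g, hg, rfl⟩ | rfl)
        · simpa [eval_rename] using hp g hg
        · simpa [sub_eq_zero] using hpe
    have hroots : {c : ℂ | eval (fun _ : Unit => c) f = 0}.Finite := by
      by_contra hinf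
      refine hf0 (funext_set (fun _ => {c : ℂ | eval (fun _ : Unit => c) f = 0})
        (fun _ => hinf) fun x hx => ?_)
      simpa using hx () (Set.mem_univ _)
    rcases hf with hf | hf
    · exfalso
      refine not_countable_complex ((hroots.countable.union
        (hG.image (fun p : τ → ℂ => p e))).mono fun c _ => ?_)
      by_cases hc : eval (fun _ : Unit => c) f = 0
      · exact Or.inl hc
      · exact Or.inr ((key fun _ => c).mp (hf _ hc))
    · refine hroots.subset fun c hc => ?_
      by_contra hc'
      exact hf (fun _ => c) hc' ((key fun _ => c).mpr hc)
  exact (Set.Finite.pi' hcoord).subset fun p hp e => ⟨p, hp, rfl⟩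

theorem volume_zeros_fin {n : ℕ} (f : MvPolynomial (Fin n) ℂ) (hf : f ≠ 0) :
    volume {x : Fin n → ℂ | eval x f = 0} = 0 := by
  induction n with
  | zero =>
    have : {x : Fin 0 → ℂ | eval x f = 0} = ∅ := by
      ext x
      simp only [Set.mem_ofPred_eq, Set.mem_empty_iff_false, iff_false]
      intro hx
      refine hf (MvPolynomial.funext fun y => ?_)
      rw [Subsingleton.elim y x, hx, map_zero]
    rw [this, measure_empty]
  | succ n ih =>
    have hmeas : ∀ {m : ℕ} (g : MvPolynomial (Fin m) ℂ),
        MeasurableSet {x : Fin m → ℂ | eval x g = 0} := fun g =>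
      (isClosed_eq (MvPolynomial.continuous_eval g) continuous_const).measurableSet
    have hpres := (volume_preserving_piFinSuccAbove (fun _ : Fin (n + 1) => ℂ) 0).symm
    rw [← hpres.measure_preimage (hmeas f).nullMeasurableSet]
    rw [Measure.volume_eq_prod, Measure.measure_prod_null (hpres.measurable (hmeas f))]
    have hF : finSuccEquiv ℂ n f ≠ 0 := by simpa using hf
    have hfin : {r : ℂ | (finSuccEquiv ℂ n f).eval (C r) = 0}.Finite := by
      refine Set.Finite.of_finite_image (f := (C : ℂ → MvPolynomial (Fin n) ℂ)) ?_
        (C_injective _ _).injOn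
      refine (finSuccEquiv ℂ n f).roots.toFinset.finite_toSet.subset ?_
      rintro _ ⟨r, hr, rfl⟩
      simpa [hf] using hr
    have hae : ∀ᵐ r : ℂ, (finSuccEquiv ℂ n f).eval (C r) ≠ 0 := by
      rw [ae_iff]
      simpa using hfin.measure_zero volume
    filter_upwards [hae] with r hr
    refine measure_mono_null ?_ (ih _ hr)
    intro x hx
    simp only [Set.mem_preimage, Set.mem_ofPred_eq] at hx ⊢
    rw [eval_polynomial_eval_finSuccEquiv]
    convert hx using 3
    ext i
    refine Fin.cases ?_ (fun i => ?_) i <;>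
      simp [MeasurableEquiv.piFinSuccAbove, Fin.insertNthEquiv]

/-- The zero set of a nonzero complex polynomial is a Lebesgue null set. -/
theorem ae_eval_ne_zero {σ : Type*} [Fintype σ] (f : MvPolynomial σ ℂ) (hf : f ≠ 0) :
    ∀ᵐ x : σ → ℂ, eval x f ≠ 0 := by
  let e := Fintype.equivFin σ
  have h := volume_zeros_fin (rename e f) fun h => hf (rename_injective e e.injective (by simpa))
  have hpres := volume_preserving_arrowCongr' e.symm (MeasurableEquiv.refl ℂ)
    (MeasurePreserving.id volume)
  rw [ae_iff]
  simp only [ne_eq, not_not]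
  have hms : MeasurableSet {x : σ → ℂ | eval x f = 0} :=
    (isClosed_eq (MvPolynomial.continuous_eval f) continuous_const).measurableSet
  rw [← hpres.measure_preimage hms.nullMeasurableSet]
  refine measure_mono_null (fun x hx => ?_) h
  simp only [Set.mem_preimage, Set.mem_ofPred_eq] at hx ⊢
  rw [eval_rename]
  exact hx

/-! ### Torus points of a log-linear model -/

section LogLinear

open Matrix

variable {ρ E : Type*} [Fintype ρ]

/-- The torus point of the log-linear model of `A` with logarithmic parameters `η`, that is the
coordinatewise exponential of `Aᵀ η`. -/
noncomputable def expPoint (A : Matrix ρ E ℂ) (η : ρ → ℂ) : E → ℂ :=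
  fun e => Complex.exp ((Aᵀ *ᵥ η) e)

/-- The derivative of `w ↦ exp (Aᵀ (R w)) + K w`. -/
noncomputable def expAddDeriv (A : Matrix ρ E ℂ) (R : (E → ℂ) →L[ℂ] (ρ → ℂ))
    (K : (E → ℂ) →L[ℂ] (E → ℂ)) (w : E → ℂ) : (E → ℂ) →L[ℂ] (E → ℂ) :=
  ContinuousLinearMap.pi fun e => expPoint A (R w) e •
    ((ContinuousLinearMap.proj e).comp (Aᵀ.mulVecLin.toContinuousLinearMap.comp R))
      + (ContinuousLinearMap.proj e).comp K

theorem expAddDeriv_apply (A : Matrix ρ E ℂ) (R : (E → ℂ) →L[ℂ] (ρ → ℂ))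
    (K : (E → ℂ) →L[ℂ] (E → ℂ)) (w v : E → ℂ) :
    expAddDeriv A R K w v = expPoint A (R w) * (Aᵀ *ᵥ (R v)) + K v := by
  rfl

theorem hasStrictFDerivAt_expPoint (A : Matrix ρ E ℂ) (η : ρ → ℂ) (e : E) :
    HasStrictFDerivAt (fun η => expPoint A η e) (expPoint A η e •
      (ContinuousLinearMap.proj (R := ℂ) (φ := fun _ : E => ℂ) e).comp
        Aᵀ.mulVecLin.toContinuousLinearMap) η :=
  ((ContinuousLinearMap.proj (R := ℂ) (φ := fun _ : E => ℂ) e).comp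
        Aᵀ.mulVecLin.toContinuousLinearMap).hasStrictFDerivAt.cexp

variable [Fintype E]

/-- A point `p` is nondegenerate if the linear map `A` is injective on the tangent space
`p · range Aᵀ` of the torus orbit at `p`. -/
def Nondegenerate (A : Matrix ρ E ℂ) (p : E → ℂ) : Prop :=
  ∀ η, A *ᵥ (p * (Aᵀ *ᵥ η)) = 0 → Aᵀ *ᵥ η = 0

/-- Sard's theorem in equal dimensions, for complex derivatives. The derivatives are taken within
`s`, so they need not be unique. -/
theorem volume_image_eq_zero_of_not_injective {f : (E → ℂ) → E → ℂ} {s : Set (E → ℂ)}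
    (f' : (E → ℂ) → (E → ℂ) →L[ℂ] (E → ℂ)) (hf : ∀ x ∈ s, HasFDerivWithinAt f (f' x) s x)
    (hs : ∀ x ∈ s, ∃ v, v ≠ 0 ∧ f' x v = 0) : volume (f '' s) = 0 := by
  refine addHaar_image_eq_zero_of_det_fderivWithin_eq_zero volume
    (f' := fun x => (f' x).restrictScalars ℝ) (fun x hx => (hf x hx).restrictScalars ℝ)
    fun x hx => ?_
  obtain ⟨v, hv, hv0⟩ := hs x hx
  rw [ContinuousLinearMap.det]
  by_contra hdet
  exact hv ((LinearMap.equivOfDetNeZero _ hdet).injective (by simpa using hv0))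

/-- `ℂ^E` is isomorphic to `range Aᵀ × ker A`. The isomorphism is encoded by a linear map `R`,
whose composition with `Aᵀ` is the first component, and by the second component `K`. -/
theorem exists_range_prod_ker_coordinates (A : Matrix ρ E ℂ) :
    ∃ (R : (E → ℂ) →L[ℂ] (ρ → ℂ)) (K : (E → ℂ) →L[ℂ] (E → ℂ)),
      (∀ v, A *ᵥ (K v) = 0) ∧
      (∀ η κ, A *ᵥ κ = 0 → ∃ w, Aᵀ *ᵥ (R w) = Aᵀ *ᵥ η ∧ K w = κ) ∧
      (∀ v, Aᵀ *ᵥ (R v) = 0 → K v = 0 → v = 0) := by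
  classical
  have hfin : Module.finrank ℂ (E → ℂ) = Module.finrank ℂ
      (LinearMap.range Aᵀ.mulVecLin × LinearMap.ker A.mulVecLin) := by
    rw [Module.finrank_prod, ← LinearMap.finrank_range_add_finrank_ker A.mulVecLin]
    congr 1
    exact (Matrix.rank_transpose A).symm
  let T := LinearEquiv.ofFinrankEq _ _ hfin
  obtain ⟨g, hg⟩ := LinearMap.exists_rightInverse_of_surjective
    Aᵀ.mulVecLin.rangeRestrict (LinearMap.range_rangeRestrict _)
  have hg' : ∀ x, Aᵀ *ᵥ (g x) = x := fun x =>
    congrArg Subtype.val (LinearMap.congr_fun hg x)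
  refine ⟨LinearMap.toContinuousLinearMap (g ∘ₗ LinearMap.fst _ _ _ ∘ₗ T.toLinearMap),
    LinearMap.toContinuousLinearMap (Submodule.subtype _ ∘ₗ LinearMap.snd _ _ _ ∘ₗ T.toLinearMap),
    fun v => (T v).2.2, fun η κ hκ => ?_, fun v h1 h2 => ?_⟩
  · refine ⟨T.symm (⟨Aᵀ *ᵥ η, ⟨η, rfl⟩⟩, ⟨κ, hκ⟩), ?_, ?_⟩
    · simp [hg']
    · simp
  · apply T.injective
    rw [map_zero]
    ext1
    · ext1
      simpa [hg'] using h1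
    · ext1
      simpa using h2

theorem hasFDerivAt_expAdd (A : Matrix ρ E ℂ) (R : (E → ℂ) →L[ℂ] (ρ → ℂ))
    (K : (E → ℂ) →L[ℂ] (E → ℂ)) (w : E → ℂ) :
    HasFDerivAt (fun w => expPoint A (R w) + K w) (expAddDeriv A R K w) w := by
  rw [hasFDerivAt_pi']
  intro e
  have h := ((hasStrictFDerivAt_expPoint A (R w) e).hasFDerivAt.comp w R.hasFDerivAt).add
    ((ContinuousLinearMap.proj (R := ℂ) (φ := fun _ : E => ℂ) e).comp K).hasFDerivAt
  exact h

/-- By Sard's theorem, for almost all data all torus solutions are nondegenerate. -/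
theorem ae_nondegenerate (A : Matrix ρ E ℂ) :
    ∀ᵐ u : E → ℂ, ∀ η, A *ᵥ (expPoint A η - u) = 0 → Nondegenerate A (expPoint A η) := by
  obtain ⟨R, K, hK, hRK, -⟩ := exists_range_prod_ker_coordinates A
  have h0 := volume_image_eq_zero_of_not_injective
    (f := fun w => expPoint A (R w) + K w) (s := {w | ¬ Nondegenerate A (expPoint A (R w))})
    (expAddDeriv A R K) (fun w _ => (hasFDerivAt_expAdd A R K w).hasFDerivWithinAt) ?_
  · rw [ae_iff]
    refine measure_mono_null (fun u hu => ?_) h0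
    simp only [not_forall] at hu
    obtain ⟨η, hη, hN⟩ := hu
    obtain ⟨w, hw1, hw2⟩ := hRK η (u - expPoint A η) (by
      rw [← neg_sub, mulVec_neg, hη, neg_zero])
    have hw : expPoint A (R w) = expPoint A η := by
      unfold expPoint
      rw [hw1]
    refine ⟨w, ?_, ?_⟩
    · change ¬ Nondegenerate A (expPoint A (R w))
      rwa [hw]
    · simp [hw, hw2]
  -- A degenerate direction `λ` gives `p λ ∈ ker A`, so the derivative kills `(λ, -p λ)`.
  · intro w hw
    simp only [Nondegenerate, Set.mem_ofPred_eq, not_forall] at hw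
    obtain ⟨η, hη, hne⟩ := hw
    obtain ⟨v, hv1, hv2⟩ := hRK η (-(expPoint A (R w) * (Aᵀ *ᵥ η))) (by
      rw [mulVec_neg, hη, neg_zero])
    refine ⟨v, ?_, ?_⟩
    · rintro rfl
      apply hne
      rw [← hv1, map_zero, mulVec_zero]
    · rw [expAddDeriv_apply, hv1, hv2, add_neg_cancel]

/-- Nondegenerate solutions are isolated, so there are at most countably many of them. -/
theorem ae_countable_expPoint (A : Matrix ρ E ℂ) :
    ∀ᵐ u : E → ℂ, {p | ∃ η, p = expPoint A η ∧ A *ᵥ (p - u) = 0}.Countable := by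
  obtain ⟨R, K, hK, hRK, hinj⟩ := exists_range_prod_ker_coordinates A
  filter_upwards [ae_nondegenerate A] with u hu
  set F : Set (E → ℂ) := {w | expPoint A (R w) + K w = u}
  have hFc : F.Countable := by
    have hdisc : DiscreteTopology F := by
      refine discreteTopology_subtype_iff.mpr fun w hw => ?_
      have hN : Nondegenerate A (expPoint A (R w)) := by
        refine hu _ ?_
        have : expPoint A (R w) - u = - K w := by
          rw [← show expPoint A (R w) + K w = u from hw]
          abel
        rw [this, mulVec_neg, hK, neg_zero]
      have hker : LinearMap.ker (expAddDeriv A R K w : (E → ℂ) →ₗ[ℂ] (E → ℂ)) = ⊥ := by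
        rw [LinearMap.ker_eq_bot']
        intro v hv
        have hv' : expPoint A (R w) * (Aᵀ *ᵥ (R v)) + K v = 0 := by
          rw [← expAddDeriv_apply]
          exact hv
        have h1 : Aᵀ *ᵥ (R v) = 0 := by
          refine hN _ ?_
          rw [eq_neg_of_add_eq_zero_left hv', mulVec_neg, hK, neg_zero]
        refine hinj v h1 ?_
        rwa [h1, mul_zero, zero_add] at hv'
      obtain ⟨c, -, hc⟩ := LinearMap.exists_antilipschitzWith _ hker
      have h2 := (hasFDerivAt_expAdd A R K w).eventually_ne (c := u) ⟨c, hc⟩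
      rw [← Filter.empty_mem_iff_bot]
      filter_upwards [Filter.mem_inf_of_left h2, Filter.mem_inf_of_right
        (Filter.mem_principal_self F)] with z hz1 hz2
      exact hz1 hz2
    exact (HereditarilyLindelofSpace.isLindelof F).countable hdisc
  refine (hFc.image fun w => expPoint A (R w)).mono ?_
  rintro p ⟨η, rfl, hη⟩
  obtain ⟨w, hw1, hw2⟩ := hRK η (u - expPoint A η) (by
    rw [← neg_sub, mulVec_neg, hη, neg_zero])
  have hw : expPoint A (R w) = expPoint A η := by
    unfold expPoint
    rw [hw1]
  refine ⟨w, ?_, hw⟩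
  change expPoint A (R w) + K w = u
  simp [hw, hw2]

/-- For almost all data no torus solution satisfies a given equation
`∑ y ∈ Y, exp (ℓ y η) = 0`. The hypotheses say that the vanishing of the sum depends only on the
torus point, and that one summand can be varied without changing the others. -/
theorem ae_sum_exp_ne_zero {ι : Type*} (A : Matrix ρ E ℂ) (Y : Finset ι)
    (ℓ : ι → (ρ → ℂ) →L[ℂ] ℂ) {y₀ : ι} (hy₀ : y₀ ∈ Y) (δ : ρ → ℂ) (hδ : ℓ y₀ δ = 1)
    (hδ' : ∀ y ∈ Y, y ≠ y₀ → ℓ y δ = 0)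
    (hker : ∀ κ, Aᵀ *ᵥ κ = 0 → ∀ y ∈ Y, ℓ y κ = ℓ y₀ κ) :
    ∀ᵐ u : E → ℂ, ∀ η, A *ᵥ (expPoint A η - u) = 0 → ∑ y ∈ Y, Complex.exp (ℓ y η) ≠ 0 := by
  classical
  obtain ⟨R, K, hK, hRK, -⟩ := exists_range_prod_ker_coordinates A
  let h : (E → ℂ) → ℂ := fun w => ∑ y ∈ Y, Complex.exp (ℓ y (R w))
  let h' : (E → ℂ) → (E → ℂ) →L[ℂ] ℂ := fun w =>
    ∑ y ∈ Y, Complex.exp (ℓ y (R w)) • (ℓ y).comp R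
  have hh : ∀ w, HasFDerivAt h (h' w) w := fun w =>
    HasFDerivAt.fun_sum fun y _ => ((ℓ y).comp R).hasFDerivAt.cexp
  obtain ⟨v, hv1, hv2⟩ := hRK δ 0 (mulVec_zero _)
  have hRv : ∀ y ∈ Y, ℓ y (R v) = ℓ y δ + ℓ y₀ (R v - δ) := by
    intro y hy
    rw [← hker (R v - δ) (by rw [mulVec_sub, hv1, sub_self]) y hy, ← map_add, add_sub_cancel]
  have hh'v : ∀ w, h w = 0 → h' w v = Complex.exp (ℓ y₀ (R w)) := by
    intro w hw
    have h1 : h' w v = ∑ y ∈ Y, Complex.exp (ℓ y (R w)) * ℓ y δ +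
        h w * ℓ y₀ (R v - δ) := by
      simp only [h', h, _root_.sum_apply, _root_.smul_apply,
        ContinuousLinearMap.comp_apply, smul_eq_mul]
      rw [Finset.sum_mul, ← Finset.sum_add_distrib]
      refine Finset.sum_congr rfl fun y hy => ?_
      rw [hRv y hy, mul_add]
    rw [h1, hw, zero_mul, add_zero, Finset.sum_eq_single_of_mem y₀ hy₀, hδ, mul_one]
    intro y hy hne
    rw [hδ' y hy hne, mul_zero]
  have h0 := volume_image_eq_zero_of_not_injective
    (f := fun w => expPoint A (R w) + K w) (s := {w | h w = 0})
    (fun w => expAddDeriv A R K w - (h' w).smulRight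
      ((Complex.exp (ℓ y₀ (R w)))⁻¹ • expAddDeriv A R K w v)) ?_ ?_
  · rw [ae_iff]
    refine measure_mono_null (fun u hu => ?_) h0
    simp only [not_forall, not_not] at hu
    obtain ⟨η, hη, hN⟩ := hu
    obtain ⟨w, hw1, hw2⟩ := hRK η (u - expPoint A η) (by
      rw [← neg_sub, mulVec_neg, hη, neg_zero])
    have hw : expPoint A (R w) = expPoint A η := by
      unfold expPoint
      rw [hw1]
    refine ⟨w, ?_, ?_⟩
    · have h2 : ∀ y ∈ Y, ℓ y (R w) = ℓ y η + ℓ y₀ (R w - η) := by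
        intro y hy
        rw [← hker (R w - η) (by rw [mulVec_sub, hw1, sub_self]) y hy, ← map_add, add_sub_cancel]
      change ∑ y ∈ Y, Complex.exp (ℓ y (R w)) = 0
      rw [Finset.sum_congr rfl fun y hy => by rw [h2 y hy, Complex.exp_add], ← Finset.sum_mul, hN,
        zero_mul]
    · simp [hw, hw2]
  · intro w hw
    -- On `{h = 0}` the map agrees with itself minus `h` times a constant vector.
    set a := (Complex.exp (ℓ y₀ (R w)))⁻¹ • expAddDeriv A R K w v
    have h3 := ((hasFDerivAt_expAdd A R K w).sub ((hh w).smul_const a)).hasFDerivWithinAt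
      (s := {w | h w = 0})
    refine h3.congr (fun z hz => ?_) ?_
    · rw [Pi.sub_apply, show h z = 0 from hz, zero_smul, sub_zero]
    · rw [Pi.sub_apply, show h w = 0 from hw, zero_smul, sub_zero]
  · intro w hw
    refine ⟨v, ?_, ?_⟩
    · rintro rfl
      exact Complex.exp_ne_zero _ ((hh'v w hw).symm.trans (map_zero _))
    rw [_root_.sub_apply, ContinuousLinearMap.smulRight_apply, hh'v w hw, smul_smul,
      mul_inv_cancel₀ (Complex.exp_ne_zero _), one_smul, sub_self]

/-- If the only element of `range Aᵀ` orthogonal to `S` is `0`, then `S` and `ker A` span. -/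
theorem sup_ker_eq_top_of_dotProduct (A : Matrix ρ E ℂ) (S : Submodule ℂ (E → ℂ))
    (hS : ∀ η, (∀ v ∈ S, (Aᵀ *ᵥ η) ⬝ᵥ v = 0) → Aᵀ *ᵥ η = 0) :
    S ⊔ LinearMap.ker A.mulVecLin = ⊤ := by
  classical
  by_contra hne
  obtain ⟨f, hf0, hf⟩ := Submodule.exists_le_ker_of_lt_top _ (lt_top_iff_ne_top.mpr hne)
  have hfA : f ∈ LinearMap.range A.mulVecLin.dualMap := by
    rw [LinearMap.range_dualMap_eq_dualAnnihilator_ker, Submodule.mem_dualAnnihilator]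
    exact fun w hw => hf (Submodule.mem_sup_right hw)
  obtain ⟨g, rfl⟩ := hfA
  have hg : ∀ v : E → ℂ, g (A *ᵥ v) = (Aᵀ *ᵥ (fun r => g (Pi.single r 1))) ⬝ᵥ v := by
    intro v
    rw [mulVec_transpose, ← dotProduct_mulVec, LinearMap.pi_apply_eq_sum_univ g]
    refine Finset.sum_congr rfl fun r _ => ?_
    rw [smul_eq_mul, mul_comm]
    congr 2
    ext j
    simp [Pi.single_apply, eq_comm]
  have h0 := hS _ fun v hv => (hg v).symm.trans (hf (Submodule.mem_sup_left hv))
  apply hf0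
  refine LinearMap.pi_ext' fun v => LinearMap.ext_ring ?_
  change g (A *ᵥ (Pi.single v 1)) = 0
  rw [hg, h0, zero_dotProduct]

end LogLinear

open Matrix in
/-- Solutions persist under small changes of the data at any point of a parametrized family whose
tangent space spans together with `ker A`. -/
theorem eventually_exists_solution {ρ E X : Type*} [Fintype E] [NormedAddCommGroup X]
    [NormedSpace ℂ X] [CompleteSpace X] (A : Matrix ρ E ℂ) {Φ : X → E → ℂ} {Φ' : X →L[ℂ] (E → ℂ)} {x₀ : X}
    (hΦ : HasStrictFDerivAt Φ Φ' x₀)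
    (hsup : LinearMap.range (Φ' : X →ₗ[ℂ] (E → ℂ)) ⊔ LinearMap.ker A.mulVecLin = ⊤)
    {u₀ : E → ℂ} (hu₀ : A *ᵥ (Φ x₀ - u₀) = 0) {O : Set (E → ℂ)} (hO : O ∈ nhds (Φ x₀)) :
    ∀ᶠ u in nhds u₀, ∃ x, Φ x ∈ O ∧ A *ᵥ (Φ x - u) = 0 := by
  let N := LinearMap.ker A.mulVecLin
  let G : X × N → E → ℂ := fun z => Φ z.1 + z.2
  let G' : X × N →L[ℂ] (E → ℂ) := Φ'.comp (ContinuousLinearMap.fst ℂ X N) +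
    N.subtypeL.comp (ContinuousLinearMap.snd ℂ X N)
  let κ₀ : N := ⟨u₀ - Φ x₀, by
    change A *ᵥ _ = 0
    rw [← neg_sub, mulVec_neg, hu₀, neg_zero]⟩
  have hG : HasStrictFDerivAt G G' (x₀, κ₀) := by
    have h1 : HasStrictFDerivAt (fun z : X × N => Φ z.1)
        (Φ'.comp (ContinuousLinearMap.fst ℂ X N)) (x₀, κ₀) :=
      HasStrictFDerivAt.comp (x₀, κ₀) (g := Φ) hΦ hasStrictFDerivAt_fst
    exact h1.add (N.subtypeL.comp (ContinuousLinearMap.snd ℂ X N)).hasStrictFDerivAt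
  have hsurj : LinearMap.range (G' : X × N →ₗ[ℂ] (E → ℂ)) = ⊤ := by
    rw [eq_top_iff, ← hsup, sup_le_iff]
    constructor
    · rintro _ ⟨x, rfl⟩
      exact ⟨(x, 0), by simp [G']⟩
    · intro κ hκ
      exact ⟨(0, ⟨κ, hκ⟩), by simp [G']⟩
  have hmap := hG.map_nhds_eq_of_surj hsurj
  have hG0 : G (x₀, κ₀) = u₀ := by simp [G, κ₀]
  rw [hG0] at hmap
  have hO' : ∀ᶠ z in nhds (x₀, κ₀), Φ z.1 ∈ O :=
    (hΦ.continuousAt.comp (f := fun z : X × N => z.1) (x := (x₀, κ₀)) continuousAt_fst) hO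
  rw [← hmap]
  refine Filter.eventually_map.mpr (hO'.mono fun z hz => ⟨z.1, hz, ?_⟩)
  have : Φ z.1 - G z = -z.2.1 := by simp [G]
  rw [this, mulVec_neg, show A *ᵥ z.2.1 = 0 from z.2.2, neg_zero]

/-! ### Generic numbers of solutions -/

section GenericCount

variable {E : Type*}

/-- `d` is the number of points of `S u` for generic `u`, that is, for all `u` off the zero set of
some nonzero polynomial. -/
def IsGenericCount (S : (E → ℂ) → Set (E → ℂ)) (d : ℕ) : Prop :=
  ∃ f : MvPolynomial E ℂ, f ≠ 0 ∧ ∀ u, eval u f ≠ 0 → (S u).encard = (d : ℕ∞)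

theorem IsGenericCount.eq {S : (E → ℂ) → Set (E → ℂ)} {d e : ℕ} (hd : IsGenericCount S d)
    (he : IsGenericCount S e) : d = e := by
  obtain ⟨f, hf, hfd⟩ := hd
  obtain ⟨g, hg, hge⟩ := he
  have hne : ∃ u : E → ℂ, eval u (f * g) ≠ 0 := by
    by_contra! h
    exact mul_ne_zero hf hg (MvPolynomial.funext fun u => by simpa using h u)
  obtain ⟨u, hu⟩ := hne
  rw [map_mul] at hu
  have h := (hfd u (left_ne_zero_of_mul hu)).symm.trans (hge u (right_ne_zero_of_mul hu))
  exact_mod_cast h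

theorem natCast_le_encard_iff {α : Type*} {s : Set α} {d : ℕ} :
    (d : ℕ∞) ≤ s.encard ↔ ∃ q : Fin d → α, Function.Injective q ∧ ∀ i, q i ∈ s := by
  constructor
  · intro h
    obtain ⟨t, hts, htd⟩ := Set.exists_subset_encard_eq h
    have hfin : t.Finite := Set.finite_of_encard_eq_coe htd
    have := hfin.to_subtype
    have hcard : Nat.card t = d := by
      rw [Nat.card_coe_set_eq, Set.ncard_def, htd, ENat.toNat_natCast]
    let e := (Finite.equivFinOfCardEq hcard).symm
    exact ⟨fun i => e i, Subtype.val_injective.comp e.injective, fun i => hts (e i).2⟩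
  · rintro ⟨q, hq, hqs⟩
    calc (d : ℕ∞) = (Set.range q).encard := by
          rw [← Set.image_univ, hq.encard_image, Set.encard_univ]
          simp
      _ ≤ s.encard := Set.encard_le_encard (by rintro _ ⟨i, rfl⟩; exact hqs i)

variable [Fintype E]

/-- Having at least `d` solutions is a projection of an algebraic set: distinctness of `p` and `q`
is expressed by the solvability of `∑ e, (p e - q e) * z e = 1`. -/
theorem exists_forall_le_encard_or_forall_lt_encard (G : Set (MvPolynomial (E ⊕ E) ℂ)) (d : ℕ) :
    ∃ f : MvPolynomial E ℂ, f ≠ 0 ∧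
      ((∀ u, eval u f ≠ 0 → (d : ℕ∞) ≤ {p | ∀ g ∈ G, eval (Sum.elim u p) g = 0}.encard) ∨
        (∀ u, eval u f ≠ 0 → {p | ∀ g ∈ G, eval (Sum.elim u p) g = 0}.encard < (d : ℕ∞))) := by
  classical
  let τ := (Fin d × E) ⊕ (Fin d × Fin d × E)
  let φ : Fin d → MvPolynomial (E ⊕ E) ℂ →ₐ[ℂ] MvPolynomial (E ⊕ τ) ℂ := fun i =>
    rename (Sum.elim Sum.inl fun e => Sum.inr (Sum.inl (i, e)))
  let δ : Fin d × Fin d → MvPolynomial (E ⊕ τ) ℂ := fun ij =>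
    ∑ e, (X (Sum.inr (Sum.inl (ij.1, e))) - X (Sum.inr (Sum.inl (ij.2, e)))) *
      X (Sum.inr (Sum.inr (ij.1, ij.2, e))) - 1
  let G' : Set (MvPolynomial (E ⊕ τ) ℂ) :=
    {h | (∃ i, ∃ g ∈ G, φ i g = h) ∨ ∃ ij : Fin d × Fin d, ij.1 ≠ ij.2 ∧ δ ij = h}
  have heval : ∀ (u : E → ℂ) (p : τ → ℂ) (i : Fin d) (g : MvPolynomial (E ⊕ E) ℂ),
      eval (Sum.elim u p) (φ i g) = eval (Sum.elim u fun e => p (Sum.inl (i, e))) g := by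
    intro u p i g
    rw [eval_rename]
    congr 2
    ext (e | e) <;> simp
  have key : ∀ u : E → ℂ, (∃ p : τ → ℂ, ∀ g ∈ G', eval (Sum.elim u p) g = 0) ↔
      (d : ℕ∞) ≤ {p | ∀ g ∈ G, eval (Sum.elim u p) g = 0}.encard := by
    intro u
    rw [natCast_le_encard_iff]
    constructor
    · rintro ⟨p, hp⟩
      refine ⟨fun i e => p (Sum.inl (i, e)), fun i j hij => ?_, fun i g hg => ?_⟩
      · by_contra hne
        have h := hp _ (Or.inr ⟨(i, j), hne, rfl⟩)
        have hij' : ∀ e, p (Sum.inl (i, e)) = p (Sum.inl (j, e)) := fun e => congrFun hij e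
        simp [δ, hij'] at h
      · rw [← heval]
        exact hp _ (Or.inl ⟨i, g, hg, rfl⟩)
    · rintro ⟨q, hq, hqs⟩
      have hz : ∀ ij : Fin d × Fin d, ∃ z : E → ℂ, ij.1 ≠ ij.2 →
          ∑ e, (q ij.1 e - q ij.2 e) * z e = 1 := by
        rintro ⟨i, j⟩
        by_cases hij : i = j
        · exact ⟨0, fun h => absurd hij h⟩
        · obtain ⟨e₀, he₀⟩ := Function.ne_iff.mp (hq.ne hij)
          refine ⟨Pi.single e₀ (q i e₀ - q j e₀)⁻¹, fun _ => ?_⟩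
          rw [Finset.sum_eq_single e₀]
          · simp [sub_ne_zero.mpr he₀]
          · intro e _ he
            simp [he]
          · simp
      choose z hz using hz
      refine ⟨Sum.elim (fun ie => q ie.1 ie.2) fun ije => z (ije.1, ije.2.1) ije.2.2, ?_⟩
      rintro _ (⟨i, g, hg, rfl⟩ | ⟨ij, hij, rfl⟩)
      · rw [heval]
        exact hqs i g hg
      · simpa [δ, sub_eq_zero] using hz ij hij
  obtain ⟨f, hf0, hf⟩ := exists_forall_exists_or_forall_not_exists G'
  refine ⟨f, hf0, hf.imp (fun h u hu => (key u).mp (h u hu)) fun h u hu => ?_⟩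
  rw [← not_le, ← key u]
  exact h u hu

/-- An algebraic family whose fibres are almost all countable has a generic number of points. -/
theorem exists_isGenericCount (S : (E → ℂ) → Set (E → ℂ)) (G : Set (MvPolynomial (E ⊕ E) ℂ))
    (hS : ∀ u, S u = {p | ∀ g ∈ G, eval (Sum.elim u p) g = 0})
    (hc : ∀ᵐ u, (S u).Countable) : ∃ d, IsGenericCount S d := by
  classical
  have hdich := exists_forall_le_encard_or_forall_lt_encard G
  -- Either all `d` are attained generically, or the first one that is not gives the count.
  by_cases hall : ∀ d : ℕ, ∃ f : MvPolynomial E ℂ, f ≠ 0 ∧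
      ∀ u, eval u f ≠ 0 → (d : ℕ∞) ≤ (S u).encard
  · exfalso
    choose f hf0 hf using hall
    obtain ⟨u, hu, hcu⟩ := ((ae_all_iff.mpr fun d => ae_eval_ne_zero (f d) (hf0 d)).and hc).exists
    have hfin : (S u).Finite := by
      let ψ : MvPolynomial (E ⊕ E) ℂ →ₐ[ℂ] MvPolynomial E ℂ :=
        aeval (Sum.elim (fun e => C (u e)) X)
      have hψ : ∀ (p : E → ℂ) g, eval p (ψ g) = eval (Sum.elim u p) g := by
        intro p g
        have h : (aeval p).comp ψ = aeval (Sum.elim u p) := by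
          ext (e | e) <;> simp [ψ]
        simpa [aeval_eq_eval] using DFunLike.congr_fun h g
      have hSψ : S u = {p | ∀ g ∈ ψ '' G, eval p g = 0} := by
        rw [hS]
        ext p
        simp [hψ]
      rw [hSψ] at hcu ⊢
      exact finite_of_countable_zeros _ hcu
    have h := hf ((S u).ncard + 1) u (hu _)
    rw [← hfin.cast_ncard_eq] at h
    exact absurd (Nat.cast_le.mp h) (by simp)
  · push Not at hall
    have hex := hall
    set d := Nat.find hex with hd
    have hdspec := Nat.find_spec hex
    rw [← hd] at hdspec
    obtain ⟨f₁, hf₁, h₁⟩ := hdich d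
    have hlt : ∀ u, eval u f₁ ≠ 0 → (S u).encard < d := by
      rcases h₁ with h₁ | h₁
      · obtain ⟨u, hu, hu'⟩ := hdspec f₁ hf₁
        rw [hS] at hu'
        exact absurd (h₁ u hu) (not_le.mpr hu')
      · intro u hu
        rw [hS]
        exact h₁ u hu
    obtain ⟨u, hu, -⟩ := hdspec f₁ hf₁
    have hdpos : d ≠ 0 := by
      intro h0
      have := hlt u hu
      rw [h0] at this
      exact absurd this (by simp)
    obtain ⟨c, hc⟩ := Nat.exists_eq_succ_of_ne_zero hdpos
    have hcmin := Nat.find_min hex (m := c) (by rw [← hd, hc]; exact Nat.lt_succ_self c)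
    push Not at hcmin
    obtain ⟨f₂, hf₂, h₂⟩ := hcmin
    refine ⟨c, f₁ * f₂, mul_ne_zero hf₁ hf₂, fun u hu => ?_⟩
    rw [map_mul] at hu
    refine le_antisymm ?_ (h₂ u (right_ne_zero_of_mul hu))
    have := hlt u (left_ne_zero_of_mul hu)
    rw [hc, Nat.succ_eq_add_one, Nat.cast_add, Nat.cast_one] at this
    exact (ENat.lt_add_one_iff (by simp)).mp this

end GenericCount

/-! ### Block models on an arbitrary vertex set -/

section BlockModel

open Matrix

/-- The dyads of an arbitrary vertex set: unordered pairs of distinct vertices. -/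
abbrev Edge (W : Type*) : Type _ := {e : Sym2 W // ¬ e.IsDiag}

/-- The edge joining two distinct vertices. -/
def Edge.mk {W : Type*} (a b : W) (h : a ≠ b) : Edge W :=
  ⟨s(a, b), fun hd => h (Sym2.mk_isDiag_iff.mp hd)⟩

theorem Edge.exists_eq_mk {W : Type*} (e : Edge W) : ∃ a b, ∃ h : a ≠ b, e = Edge.mk a b h := by
  obtain ⟨e, he⟩ := e
  induction e with
  | _ a b => exact ⟨a, b, fun h => he (Sym2.mk_isDiag_iff.mpr h), rfl⟩

theorem Edge.mk_comm {W : Type*} (a b : W) (h : a ≠ b) : Edge.mk a b h = Edge.mk b a h.symm :=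
  Subtype.ext Sym2.eq_swap

theorem subsingleton_edge_of_not_third {W : Type*} (h : ¬ ∀ a b : W, ∃ w, w ≠ a ∧ w ≠ b) :
    Subsingleton (Edge W) := by
  push Not at h
  obtain ⟨a, b, hab⟩ := h
  have hw : ∀ w, w = a ∨ w = b := fun w => or_iff_not_imp_left.mpr (hab w)
  have key : ∀ e : Edge W, e.1 = s(a, b) := by
    intro e
    obtain ⟨x, y, hxy, rfl⟩ := e.exists_eq_mk
    rcases hw x with rfl | rfl <;> rcases hw y with rfl | rfl
    · exact absurd rfl hxy
    · rfl
    · exact Sym2.eq_swap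
    · exact absurd rfl hxy
  exact ⟨fun e e' => Subtype.ext ((key e).trans (key e').symm)⟩

variable {W I : Type*} [DecidableEq W]

/-- The coordinate of `p` at the edge `{a, b}`, with value `0` for `a = b`. -/
def edgeCoord (p : Edge W → ℂ) (a b : W) : ℂ :=
  if h : a = b then 0 else p (Edge.mk a b h)

theorem edgeCoord_of_ne (p : Edge W → ℂ) {a b : W} (h : a ≠ b) :
    edgeCoord p a b = p (Edge.mk a b h) := dif_neg h

theorem edgeCoord_comm (p : Edge W → ℂ) (a b : W) : edgeCoord p a b = edgeCoord p b a := by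
  unfold edgeCoord
  split_ifs with h h' h'
  · rfl
  · exact absurd h.symm h'
  · exact absurd h'.symm h
  · rw [Edge.mk_comm]

/-- The quadratic equations of the block model, in uniform form: exchanging the endpoints `t`, `u`
in the same block between the edges `{t, w}`, `{u, w'}` does not change the product of the
coordinates, provided that no loop arises. -/
def SwapEqs (bl : W → I) (p : Edge W → ℂ) : Prop :=
  ∀ t u w w' : W, bl t = bl u → w ≠ t → w ≠ u → w' ≠ t → w' ≠ u →
    edgeCoord p t w * edgeCoord p u w' = edgeCoord p t w' * edgeCoord p u w

/-- The swap equations with nonzero coordinates parametrize `p` as `α (β x) (β y)`. The factor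
`β x` is the quotient `p_{x w} / p_{z w}`, for a reference vertex `z` of the block of `x` and any
third vertex `w`. -/
theorem exists_factorization {bl : W → I} {p : Edge W → ℂ} (hs : SwapEqs bl p)
    (hp : ∀ e, p e ≠ 0) (hthird : ∀ a b : W, ∃ w, w ≠ a ∧ w ≠ b) :
    ∃ (α : Sym2 I → ℂ) (β : W → ℂ), (∀ b, α b ≠ 0) ∧ (∀ x, β x ≠ 0) ∧
      ∀ x y, x ≠ y → edgeCoord p x y = β x * β y * α s(bl x, bl y) := by
  have hq : ∀ a b, a ≠ b → edgeCoord p a b ≠ 0 := fun a b h => by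
    rw [edgeCoord_of_ne p h]
    exact hp _
  let z : W → W := fun x => Quotient.out (Quotient.mk (Setoid.ker bl) x)
  have hz : ∀ x, bl (z x) = bl x := fun x =>
    Quotient.exact (s := Setoid.ker bl) (Quotient.out_eq (Quotient.mk (Setoid.ker bl) x))
  have hzz : ∀ x x', bl x = bl x' → z x = z x' := fun x x' h => by
    simp only [z]
    rw [Quotient.sound (s := Setoid.ker bl) h]
  choose third h3 using hthird
  let β : W → ℂ := fun x => edgeCoord p x (third x (z x)) / edgeCoord p (z x) (third x (z x))
  have hβ0 : ∀ x, β x ≠ 0 := fun x =>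
    div_ne_zero (hq _ _ (h3 _ _).1.symm) (hq _ _ (h3 _ _).2.symm)
  have hβ : ∀ x w, w ≠ x → w ≠ z x → β x * edgeCoord p (z x) w = edgeCoord p x w := by
    intro x w h1 h2
    have := hs x (z x) w (third x (z x)) (hz x).symm h1 h2 (h3 _ _).1 (h3 _ _).2
    simp only [β]
    rw [div_mul_eq_mul_div, div_eq_iff (hq _ _ (h3 _ _).2.symm)]
    exact this.symm
  have hK : ∀ x x' w, bl x = bl x' → w ≠ x → w ≠ x' →
      edgeCoord p x w * β x' = edgeCoord p x' w * β x := by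
    intro x x' w hxx h1 h2
    have hzx := hzz x x' hxx
    by_cases hw : w = z x
    · by_cases hxx' : x = x'
      · rw [hxx']
      have e1 := hβ x x' (Ne.symm hxx') (hw ▸ h2.symm)
      have e2 := hβ x' x hxx' (hzx ▸ hw ▸ h1.symm)
      rw [← hzx, ← hw, edgeCoord_comm p w] at e2
      rw [← hw, edgeCoord_comm p w] at e1
      rw [mul_comm, e2, mul_comm, e1, edgeCoord_comm]
    · have e1 := hβ x w h1 hw
      have e2 := hβ x' w h2 (hzx ▸ hw)
      rw [← e1, ← e2, hzx]
      ring
  have hKK : ∀ x y x' y', x ≠ y → x' ≠ y' → bl x = bl x' → bl y = bl y' →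
      edgeCoord p x y * (β x' * β y') = edgeCoord p x' y' * (β x * β y) := by
    have aux : ∀ x y x' y', x ≠ y → x' ≠ y' → bl x = bl x' → bl y = bl y' → x' ≠ y →
        edgeCoord p x y * (β x' * β y') = edgeCoord p x' y' * (β x * β y) := by
      intro x y x' y' h1 h2 hx hy h
      have e1 := hK x x' y hx h1.symm h.symm
      have e2 := hK y y' x' hy h h2
      rw [edgeCoord_comm p y, edgeCoord_comm p y'] at e2
      linear_combination β y' * e1 + β x * e2
    intro x y x' y' h1 h2 hx hy
    by_cases h : x' = y
    · by_cases h' : x = y'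
      · rw [h, ← h', edgeCoord_comm]
        ring
      · have := aux y x y' x' h1.symm h2.symm hy hx (Ne.symm h')
        rw [edgeCoord_comm p y, edgeCoord_comm p y'] at this
        linear_combination this
    · exact aux x y x' y' h1 h2 hx hy h
  classical
  let α : Sym2 I → ℂ := fun b =>
    if h : ∃ xy : W × W, xy.1 ≠ xy.2 ∧ s(bl xy.1, bl xy.2) = b then
      edgeCoord p h.choose.1 h.choose.2 / (β h.choose.1 * β h.choose.2) else 1
  refine ⟨α, β, fun b => ?_, hβ0, fun x y hxy => ?_⟩
  · simp only [α]
    split_ifs with h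
    · exact div_ne_zero (hq _ _ h.choose_spec.1) (mul_ne_zero (hβ0 _) (hβ0 _))
    · exact one_ne_zero
  · have h : ∃ xy : W × W, xy.1 ≠ xy.2 ∧ s(bl xy.1, bl xy.2) = s(bl x, bl y) :=
      ⟨(x, y), hxy, rfl⟩
    simp only [α]
    rw [dif_pos h]
    obtain ⟨hne, hbl⟩ := h.choose_spec
    rw [mul_div_assoc', eq_div_iff (mul_ne_zero (hβ0 _) (hβ0 _)), mul_comm (β x * β y)]
    rcases Sym2.eq_iff.mp hbl with ⟨h1, h2⟩ | ⟨h1, h2⟩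
    · exact hKK _ _ _ _ hxy hne h1.symm h2.symm
    · have := hKK _ _ _ _ hxy.symm hne h1.symm h2.symm
      rw [edgeCoord_comm p y] at this
      rw [this]
      ring

variable [DecidableEq I]

/-- The design matrix of the block model with block map `bl`. -/
def blockDesign (bl : W → I) : Matrix (W ⊕ Sym2 I) (Edge W) ℂ :=
  Matrix.of fun r e =>
    match r with
    | Sum.inl x => if x ∈ e.1 then 1 else 0
    | Sum.inr b => if e.1.map bl = b then 1 else 0

/-- The solutions of the likelihood equations of the block model with block map `bl`. -/
def blockSolutions [Fintype W] (bl : W → I) (u : Edge W → ℂ) : Set (Edge W → ℂ) :=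
  {p | blockDesign bl *ᵥ (p - u) = 0 ∧ SwapEqs bl p}

theorem blockDesign_transpose_mulVec [Fintype W] [Fintype I] (bl : W → I) (η : W ⊕ Sym2 I → ℂ)
    (a b : W) (h : a ≠ b) : ((blockDesign bl)ᵀ *ᵥ η) (Edge.mk a b h) =
      η (Sum.inl a) + η (Sum.inl b) + η (Sum.inr s(bl a, bl b)) := by
  have h1 : ∀ x, blockDesign bl (Sum.inl x) (Edge.mk a b h) = if x = a ∨ x = b then 1 else 0 :=
    fun _ => if_congr Sym2.mem_iff rfl rfl
  have h2 : ∀ c, blockDesign bl (Sum.inr c) (Edge.mk a b h) =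
      if s(bl a, bl b) = c then 1 else 0 := fun _ => if_congr Iff.rfl rfl rfl
  simp only [mulVec, dotProduct, transpose_apply, Fintype.sum_sum_type, h1, h2, ite_mul, one_mul,
    zero_mul]
  congr 1
  · rw [← Finset.sum_filter]
    have : (Finset.univ.filter fun x => x = a ∨ x = b) = {a, b} := by
      ext x
      simp
    rw [this, Finset.sum_pair h]
  · simp

section Rows

variable [Fintype W] (bl : W → I) (v : Edge W → ℂ)

theorem blockDesign_mulVec_inl (x : W) :
    (blockDesign bl *ᵥ v) (Sum.inl x) =
      ∑ e ∈ Finset.univ.filter fun e : Edge W => x ∈ e.1, v e := by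
  simp [mulVec, dotProduct, blockDesign, Finset.sum_filter]

theorem blockDesign_mulVec_inr (b : Sym2 I) :
    (blockDesign bl *ᵥ v) (Sum.inr b) =
      ∑ e ∈ Finset.univ.filter fun e : Edge W => e.1.map bl = b, v e := by
  simp [mulVec, dotProduct, blockDesign, Finset.sum_filter]

/-- The edges that meet the block of `z` but do not contain `z` are counted by a combination of
rows of the design matrix. -/
theorem sum_edges_block_not_mem [Fintype I] (z : W) :
    ∑ e ∈ Finset.univ.filter fun e : Edge W => bl z ∈ e.1.map bl ∧ z ∉ e.1, v e =
      ∑ i, (blockDesign bl *ᵥ v) (Sum.inr s(bl z, i)) - (blockDesign bl *ᵥ v) (Sum.inl z) := by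
  simp only [blockDesign_mulVec_inl, blockDesign_mulVec_inr, Finset.sum_filter]
  rw [Finset.sum_comm, ← Finset.sum_sub_distrib]
  refine Finset.sum_congr rfl fun e _ => ?_
  have h1 : (∑ i, if e.1.map bl = s(bl z, i) then v e else 0) =
      if bl z ∈ e.1.map bl then v e else 0 := by
    by_cases hz : bl z ∈ e.1.map bl
    · obtain ⟨c, hc⟩ := Sym2.mem_iff_exists.mp hz
      rw [if_pos hz, hc, Finset.sum_eq_single c]
      · simp
      · intro i _ hi
        rw [if_neg]
        rw [Sym2.congr_right]
        exact hi.symm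
      · simp
    · rw [if_neg hz]
      refine Finset.sum_eq_zero fun i _ => if_neg fun h => hz ?_
      rw [h]
      exact Sym2.mem_mk_left _ _
  rw [h1]
  by_cases hz : z ∈ e.1
  · have : bl z ∈ e.1.map bl := Sym2.mem_map.mpr ⟨z, hz, rfl⟩
    simp [hz, this]
  · simp [hz]

end Rows

/-- A graph closed under swaps contains all edges as soon as it meets every vertex, every pair of
blocks, and, for every vertex `z`, the edges that meet the block of `z` outside `z`. -/
theorem adj_of_swap_closed {W I : Type*} {bl : W → I} {s : W → W → Prop}
    (hsymm : ∀ a b, s a b → s b a) (hirr : ∀ a b, s a b → a ≠ b)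
    (hsw : ∀ t u w w', bl t = bl u → w ≠ t → w ≠ u → w' ≠ t → w' ≠ u → s t w → s u w' → s t w')
    (hx : ∀ x y, x ≠ y → ∃ a, s x a)
    (hb : ∀ x y, x ≠ y → ∃ x' y', bl x' = bl x ∧ bl y' = bl y ∧ s x' y')
    (hρ : ∀ z w c, bl w = bl z → w ≠ z → c ≠ z → w ≠ c →
      ∃ w' c', bl w' = bl z ∧ w' ≠ z ∧ c' ≠ z ∧ s w' c') :
    ∀ x y, x ≠ y → s x y := by
  have claim : ∀ x y, bl x ≠ bl y → ∃ y', bl y' = bl y ∧ s x y' := by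
    intro x y hxy
    have hne : x ≠ y := fun h => hxy (by rw [h])
    obtain ⟨x', y', hx', hy', hs⟩ := hb x y hne
    by_cases hxx : x' = x
    · exact ⟨y', hy', hxx ▸ hs⟩
    have hyx : y' ≠ x := fun h => hxy (by rw [← hy', h])
    by_contra hno
    have hall : ∀ a, s x a → a = x' := by
      intro a ha
      by_contra hax
      exact hno ⟨y', hy', hsw x x' a y' hx'.symm (hirr _ _ ha).symm hax hyx
        (hirr _ _ hs).symm ha hs⟩
    obtain ⟨a, ha⟩ := hx x y hne
    have hsx : s x x' := hall a ha ▸ ha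
    obtain ⟨w, c, hw, hwx, hcx, hwc⟩ := hρ x' x y hx'.symm (Ne.symm hxx)
      (fun h => hxy (by rw [h, hx'])) hne
    have hwx' : w ≠ x := fun h => hcx (hall c (h ▸ hwc))
    have hcx' : c ≠ x := fun h => hwx (hall w (h ▸ hsymm _ _ hwc))
    exact hcx (hall c (hsw x w x' c (hx'.symm.trans hw.symm) hxx (Ne.symm hwx) hcx'
      (hirr _ _ hwc).symm hsx hwc))
  have claim₂ : ∀ x y, x ≠ y → bl x = bl y → ∃ y', bl y' = bl x ∧ s x y' := by
    intro x y hne hxy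
    obtain ⟨x', y', hx', hy', hs⟩ := hb x y hne
    obtain ⟨a, ha⟩ := hx x y hne
    by_cases hax : bl a = bl x
    · exact ⟨a, hax, ha⟩
    by_cases hxx : x' = x
    · exact ⟨y', hy'.trans hxy.symm, hxx ▸ hs⟩
    by_cases hyx : y' = x
    · exact ⟨x', hx', hsymm _ _ (hyx ▸ hs)⟩
    exact ⟨y', hy'.trans hxy.symm, hsw x x' a y' hx'.symm (hirr _ _ ha).symm
      (fun h => hax (by rw [h, hx'])) hyx (hirr _ _ hs).symm ha hs⟩
  intro x y hne
  by_cases hxy : bl x = bl y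
  · by_contra hno
    have hno' : ¬ s y x := fun h => hno (hsymm _ _ h)
    -- Every neighbour of `x` equals every neighbour of `y`, since otherwise a swap joins `x`
    -- and `y`.
    have hnb : ∀ a b, s x a → s y b → a = b := by
      intro a b ha hb'
      by_contra hab
      have hay : a ≠ y := fun h => hno (h ▸ ha)
      have hbx : b ≠ x := fun h => hno' (h ▸ hb')
      by_cases hbla : bl a = bl x
      · exact hno' (hsw y a b x (by rw [hbla, hxy]) (hirr _ _ hb').symm (Ne.symm hab) hne
          (hirr _ _ ha) hb' (hsymm _ _ ha))
      obtain ⟨z, hz, hyz⟩ := claim₂ y x hne.symm hxy.symm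
      have hzx : z ≠ x := fun h => hno' (h ▸ hyz)
      exact hno (hsw x z a y (hxy.trans hz.symm) (hirr _ _ ha).symm
        (fun h => hbla (by rw [h, hz, hxy])) hne.symm (hirr _ _ hyz) ha (hsymm _ _ hyz))
    obtain ⟨z, hz, hxz⟩ := claim₂ x y hne hxy
    obtain ⟨b, hyb⟩ := hx y x hne.symm
    have hyz : s y z := hnb z b hxz hyb ▸ hyb
    obtain ⟨w, c, hw, hwz, hcz, hwc⟩ := hρ z x y hz.symm (hirr _ _ hxz) (hirr _ _ hyz) hne
    have hwx : w ≠ x := fun h => hcz (hnb c z (h ▸ hwc) hyz)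
    have hcx : c ≠ x := fun h => hwz (hnb w z (h ▸ hsymm _ _ hwc) hyz)
    exact hcz (hnb c z (hsw x w z c (hz.symm.trans hw.symm) (hirr _ _ hxz).symm (Ne.symm hwz) hcx
      (hirr _ _ hwc).symm hxz hwc) hyz)
  · obtain ⟨y', hy', hs⟩ := claim x y hxy
    obtain ⟨x', hx', hs'⟩ := claim y x (Ne.symm hxy)
    have hblx : ∀ v v', bl v = bl x → bl v' = bl y → v ≠ v' := fun v v' h h' hvv =>
      hxy (by rw [← h, ← h', hvv])
    exact hsymm _ _ (hsw y y' x' x hy'.symm (hblx _ _ hx' rfl) (hblx _ _ hx' hy')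
      (hblx _ _ rfl rfl) (hblx _ _ rfl hy') hs' (hsymm _ _ hs))

/-- If no subsum of the data vanishes, then all coordinates of all solutions are nonzero. -/
theorem blockSolutions_ne_zero [Fintype W] [Fintype I] {bl : W → I} {u p : Edge W → ℂ}
    (hu : ∀ T : Finset (Edge W), T.Nonempty → ∑ e ∈ T, u e ≠ 0) (hp : p ∈ blockSolutions bl u)
    (e : Edge W) : p e ≠ 0 := by
  obtain ⟨hA, hs⟩ := hp
  have hrow : ∀ r, (blockDesign bl *ᵥ p) r = (blockDesign bl *ᵥ u) r := by
    intro r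
    rw [mulVec_sub, sub_eq_zero] at hA
    rw [hA]
  have hT : ∀ T : Finset (Edge W), T.Nonempty → ∑ e ∈ T, p e = ∑ e ∈ T, u e →
      ∃ e ∈ T, p e ≠ 0 := by
    intro T hTn hTs
    by_contra! h
    exact hu T hTn (by rw [← hTs, Finset.sum_eq_zero h])
  have hmk : ∀ a b (h : a ≠ b), p (Edge.mk a b h) ≠ 0 → edgeCoord p a b ≠ 0 := by
    intro a b h hp0
    rwa [edgeCoord_of_ne p h]
  have main := adj_of_swap_closed (bl := bl) (s := fun a b => edgeCoord p a b ≠ 0)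
    (fun a b h => by rwa [edgeCoord_comm]) (fun a b h hab => h (dif_pos hab))
    (fun t v w w' htu h1 h2 h3 h4 h5 h6 =>
      left_ne_zero_of_mul (hs t v w w' htu h1 h2 h3 h4 ▸ mul_ne_zero h5 h6))
    (fun x y hxy => by
      obtain ⟨e, he, hpe⟩ := hT (Finset.univ.filter fun e : Edge W => x ∈ e.1)
        ⟨Edge.mk x y hxy, by simp [Edge.mk]⟩
        (by simpa [blockDesign_mulVec_inl] using hrow (Sum.inl x))
      obtain ⟨a, b, hab, rfl⟩ := e.exists_eq_mk
      rw [Finset.mem_filter] at he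
      rcases Sym2.mem_iff.mp he.2 with rfl | rfl
      · exact ⟨b, hmk _ _ _ hpe⟩
      · exact ⟨a, hmk _ _ _ (by rwa [← Edge.mk_comm])⟩)
    (fun x y hxy => by
      obtain ⟨e, he, hpe⟩ := hT (Finset.univ.filter fun e : Edge W => e.1.map bl = s(bl x, bl y))
        ⟨Edge.mk x y hxy, by simp [Edge.mk]⟩
        (by simpa [blockDesign_mulVec_inr] using hrow (Sum.inr s(bl x, bl y)))
      obtain ⟨a, b, hab, rfl⟩ := e.exists_eq_mk
      rw [Finset.mem_filter] at he
      have he2 : s(bl a, bl b) = s(bl x, bl y) := he.2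
      rcases Sym2.eq_iff.mp he2 with ⟨h1, h2⟩ | ⟨h1, h2⟩
      · exact ⟨a, b, h1, h2, hmk _ _ _ hpe⟩
      · exact ⟨b, a, h2, h1, hmk _ _ _ (by rwa [← Edge.mk_comm])⟩)
    (fun z w c hw hwz hcz hwc => by
      obtain ⟨e, he, hpe⟩ := hT
        (Finset.univ.filter fun e : Edge W => bl z ∈ e.1.map bl ∧ z ∉ e.1)
        ⟨Edge.mk w c hwc, by simp [Edge.mk, hw, hwz.symm, hcz.symm]⟩
        (by simp only [sum_edges_block_not_mem, hrow])
      obtain ⟨a, b, hab, rfl⟩ := e.exists_eq_mk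
      simp only [Edge.mk, Finset.mem_filter, Finset.mem_univ, true_and, Sym2.map_mk,
        Sym2.mem_iff, not_or] at he
      obtain ⟨h1 | h1, h2, h3⟩ := he
      · exact ⟨a, b, h1.symm, Ne.symm h2, Ne.symm h3, hmk _ _ _ hpe⟩
      · exact ⟨b, a, h1.symm, Ne.symm h3, Ne.symm h2, hmk _ _ _ (by rwa [← Edge.mk_comm])⟩)
  obtain ⟨a, b, hab, rfl⟩ := e.exists_eq_mk
  rw [← edgeCoord_of_ne p hab]
  exact main a b hab

/-- Points of the torus satisfy the swap equations. -/
theorem swapEqs_expPoint [Fintype W] [Fintype I] (bl : W → I) (η : W ⊕ Sym2 I → ℂ) :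
    SwapEqs bl (expPoint (blockDesign bl) η) := by
  intro t u w w' htu h1 h2 h3 h4
  rw [edgeCoord_of_ne _ h1.symm, edgeCoord_of_ne _ h2.symm, edgeCoord_of_ne _ h3.symm,
    edgeCoord_of_ne _ h4.symm]
  simp only [expPoint, blockDesign_transpose_mulVec, ← Complex.exp_add, htu]
  congr 1
  ring

/-- A point with nonzero coordinates satisfying the swap equations lies in the torus. -/
theorem exists_eq_expPoint [Fintype W] [Fintype I] {bl : W → I} {p : Edge W → ℂ}
    (hs : SwapEqs bl p) (hp : ∀ e, p e ≠ 0) : ∃ η, p = expPoint (blockDesign bl) η := by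
  by_cases hthird : ∀ a b : W, ∃ w, w ≠ a ∧ w ≠ b
  · obtain ⟨α, β, hα, hβ, hαβ⟩ := exists_factorization hs hp hthird
    refine ⟨Sum.elim (fun x => Complex.log (β x)) fun b => Complex.log (α b), ?_⟩
    ext e
    obtain ⟨a, b, hab, rfl⟩ := e.exists_eq_mk
    rw [← edgeCoord_of_ne p hab, hαβ a b hab]
    simp [expPoint, blockDesign_transpose_mulVec, Complex.exp_add, Complex.exp_log, hα, hβ]
  · have := subsingleton_edge_of_not_third hthird
    by_cases hne : Nonempty (Edge W)
    · obtain ⟨e₀⟩ := hne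
      refine ⟨Sum.elim 0 fun _ => Complex.log (p e₀), ?_⟩
      ext e
      obtain ⟨a, b, hab, rfl⟩ := e.exists_eq_mk
      rw [Subsingleton.elim (Edge.mk a b hab) e₀, expPoint,
        ← Subsingleton.elim (Edge.mk a b hab) e₀, blockDesign_transpose_mulVec]
      simp [Complex.exp_log, hp]
    · exact ⟨0, funext fun e => absurd ⟨e⟩ hne⟩

/-- For almost all data all solutions are torus points. -/
theorem ae_blockSolutions_expPoint [Fintype W] [Fintype I] (bl : W → I) :
    ∀ᵐ u : Edge W → ℂ, ∀ p ∈ blockSolutions bl u, ∃ η, p = expPoint (blockDesign bl) η := by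
  have h : ∀ T : Finset (Edge W), ∀ᵐ u : Edge W → ℂ, T.Nonempty → ∑ e ∈ T, u e ≠ 0 := by
    intro T
    by_cases hT : T.Nonempty
    · have hne : (∑ e ∈ T, X e : MvPolynomial (Edge W) ℂ) ≠ 0 := by
        intro h0
        have := congrArg (eval fun _ => (1 : ℂ)) h0
        simp [hT.ne_empty] at this
      filter_upwards [ae_eval_ne_zero _ hne] with u hu _
      simpa using hu
    · exact Filter.Eventually.of_forall fun u h => absurd h hT
  filter_upwards [ae_all_iff.mpr h] with u hu p hp
  exact exists_eq_expPoint hp.2 (blockSolutions_ne_zero hu hp)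

end BlockModel

/-! ### The generic number of solutions of a block model -/

section Count

open Matrix

open scoped ComplexOrder

theorem exists_isGenericCount_blockSolutions {W I : Type*} [DecidableEq W] [DecidableEq I]
    [Fintype W] [Fintype I] (bl : W → I) : ∃ d, IsGenericCount (blockSolutions bl) d := by
  let c : W → W → MvPolynomial (Edge W ⊕ Edge W) ℂ := fun a b =>
    if h : a = b then 0 else X (Sum.inr (Edge.mk a b h))
  have hc : ∀ (u p : Edge W → ℂ) a b, eval (Sum.elim u p) (c a b) = edgeCoord p a b := by
    intro u p a b
    simp only [c, edgeCoord]
    split_ifs <;> simp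
  let lin : W ⊕ Sym2 I → MvPolynomial (Edge W ⊕ Edge W) ℂ := fun r =>
    ∑ e, C (blockDesign bl r e) * (X (Sum.inr e) - X (Sum.inl e))
  have hlin : ∀ (u p : Edge W → ℂ) r,
      eval (Sum.elim u p) (lin r) = (blockDesign bl *ᵥ (p - u)) r := by
    intro u p r
    simp [lin, mulVec, dotProduct]
  refine exists_isGenericCount _ (Set.range lin ∪ {g | ∃ t u w w' : W,
    (bl t = bl u ∧ w ≠ t ∧ w ≠ u ∧ w' ≠ t ∧ w' ≠ u) ∧ c t w * c u w' - c t w' * c u w = g})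
    (fun u => ?_) ?_
  · ext p
    constructor
    · rintro ⟨hA, hs⟩
      rintro _ (⟨r, rfl⟩ | ⟨t, v, w, w', ⟨h1, h2, h3, h4, h5⟩, rfl⟩)
      · rw [hlin, hA, Pi.zero_apply]
      · rw [map_sub, map_mul, map_mul, hc, hc, hc, hc, hs t v w w' h1 h2 h3 h4 h5, sub_self]
    · intro h
      refine ⟨funext fun r => ?_, fun t v w w' h1 h2 h3 h4 h5 => ?_⟩
      · rw [← hlin]
        exact h _ (Or.inl ⟨r, rfl⟩)
      · have := h _ (Or.inr ⟨t, v, w, w', ⟨h1, h2, h3, h4, h5⟩, rfl⟩)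
        rwa [map_sub, map_mul, map_mul, hc, hc, hc, hc, sub_eq_zero] at this
  · filter_upwards [ae_blockSolutions_expPoint bl, ae_countable_expPoint (blockDesign bl)]
      with u hu hcu
    refine hcu.mono fun p hp => ?_
    obtain ⟨η, hη⟩ := hu p hp
    exact ⟨η, hη, hp.1⟩

theorem exists_and_of_ae_of_eventually {E : Type*} [Fintype E] {P Q : (E → ℂ) → Prop}
    {u₀ : E → ℂ} (hP : ∀ᵐ u, P u) (hQ : ∀ᶠ u in nhds u₀, Q u) : ∃ u, P u ∧ Q u := by
  obtain ⟨u, h1, h2⟩ := (Measure.dense_of_ae hP).inter_nhds_nonempty hQ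
  exact ⟨u, h1, h2⟩

theorem Nondegenerate.eq_zero_of_dotProduct {ρ E : Type*} [Fintype ρ] [Fintype E]
    {A : Matrix ρ E ℂ} {p : E → ℂ} (hp : Nondegenerate A p) {η : ρ → ℂ}
    (hη : ∀ η', (Aᵀ *ᵥ η) ⬝ᵥ (p * (Aᵀ *ᵥ η')) = 0) : Aᵀ *ᵥ η = 0 := by
  refine hp η (dotProduct_eq_zero _ fun η' => ?_)
  rw [← hη η', dotProduct_comm, dotProduct_mulVec, ← mulVec_transpose]
  simp only [dotProduct, Pi.mul_apply]
  exact Finset.sum_congr rfl fun e _ => by ring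

theorem nondegenerate_blockDesign_one {W I : Type*} [DecidableEq W] [DecidableEq I]
    [Fintype W] [Fintype I] (bl : W → I) : Nondegenerate (blockDesign bl) 1 := by
  have hreal : (blockDesign bl)ᴴ = (blockDesign bl)ᵀ := by
    ext e (x | b) <;> simp [blockDesign, apply_ite (starRingEnd ℂ)]
  intro η hη
  rw [one_mul, mulVec_mulVec, ← hreal, self_mul_conjTranspose_mulVec_eq_zero] at hη
  rw [← hreal, hη]

/-- The solution `p = 1` for the data `u = 1` is nondegenerate, hence persists. -/
theorem IsGenericCount.one_le {W I : Type*} [DecidableEq W] [DecidableEq I]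
    [Fintype W] [Fintype I] {bl : W → I} {d : ℕ} (hd : IsGenericCount (blockSolutions bl) d) :
    1 ≤ d := by
  obtain ⟨f, hf0, hf⟩ := hd
  set A := blockDesign bl
  have h0 : expPoint A 0 = 1 := by
    ext e
    simp [expPoint]
  let Φ' : (W ⊕ Sym2 I → ℂ) →L[ℂ] (Edge W → ℂ) :=
    ContinuousLinearMap.pi fun e => expPoint A 0 e •
      (ContinuousLinearMap.proj (R := ℂ) (φ := fun _ : Edge W => ℂ) e).comp
        Aᵀ.mulVecLin.toContinuousLinearMap
  have hΦ : HasStrictFDerivAt (expPoint A) Φ' 0 :=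
    hasStrictFDerivAt_pi'.mpr fun e => hasStrictFDerivAt_expPoint A 0 e
  have hsup : LinearMap.range (Φ' : (W ⊕ Sym2 I → ℂ) →ₗ[ℂ] (Edge W → ℂ)) ⊔
      LinearMap.ker A.mulVecLin = ⊤ := by
    refine sup_ker_eq_top_of_dotProduct A _ fun η hη => ?_
    refine (nondegenerate_blockDesign_one bl).eq_zero_of_dotProduct fun η' => ?_
    rw [← h0]
    exact hη _ ⟨η', rfl⟩
  obtain ⟨u, hu, η, -, hη⟩ := exists_and_of_ae_of_eventually (ae_eval_ne_zero f hf0)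
    (eventually_exists_solution A hΦ hsup (u₀ := 1) (by rw [h0, sub_self, mulVec_zero])
      Filter.univ_mem)
  have hne : (blockSolutions bl u).encard ≠ 0 :=
    Set.encard_ne_zero.mpr ⟨_, hη, swapEqs_expPoint bl η⟩
  rw [hf u hu] at hne
  exact Nat.one_le_iff_ne_zero.mpr (by exact_mod_cast hne)

/-- A model with at most one dyad has at most one solution. -/
theorem IsGenericCount.le_one {W I : Type*} [DecidableEq W] [DecidableEq I]
    [Fintype W] [Subsingleton (Edge W)] {bl : W → I} {d : ℕ}
    (hd : IsGenericCount (blockSolutions bl) d) : d ≤ 1 := by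
  obtain ⟨f, hf0, hf⟩ := hd
  obtain ⟨u, hu⟩ := (ae_eval_ne_zero f hf0).exists
  have hsub : (blockSolutions bl u).encard ≤ 1 := by
    have key : ∀ p ∈ blockSolutions bl u, p = u := by
      intro p hp
      ext e
      obtain ⟨a, b, hab, rfl⟩ := e.exists_eq_mk
      have h := congrFun hp.1 (Sum.inl a)
      rw [blockDesign_mulVec_inl, Finset.sum_eq_single_of_mem (Edge.mk a b hab)] at h
      · simpa [sub_eq_zero] using h
      · simp [Edge.mk]
      · exact fun e _ he => absurd (Subsingleton.elim _ _) he
    exact Set.encard_le_one_iff.mpr fun p q hp hq => (key p hp).trans (key q hq).symm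
  rw [hf u hu] at hsub
  exact_mod_cast hsub

end Count

/-! ### Change of labels -/

section Relabel

open Matrix

theorem blockSolutions_comp_injective {W I J : Type*} [DecidableEq W] [DecidableEq I]
    [DecidableEq J] [Fintype W] (bl : W → I) {φ : I → J} (hφ : Function.Injective φ) :
    blockSolutions (φ ∘ bl) = blockSolutions bl := by
  ext u p
  have h1 : ∀ v : Edge W → ℂ, blockDesign (φ ∘ bl) *ᵥ v = 0 ↔ blockDesign bl *ᵥ v = 0 := by
    intro v
    have hinr : ∀ b : Sym2 I, (blockDesign (φ ∘ bl) *ᵥ v) (Sum.inr (b.map φ)) =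
        (blockDesign bl *ᵥ v) (Sum.inr b) := by
      intro b
      rw [blockDesign_mulVec_inr, blockDesign_mulVec_inr]
      congr 1
      ext e
      simp only [Finset.mem_filter, Finset.mem_univ, true_and]
      rw [← Sym2.map_map, (Sym2.map.injective hφ).eq_iff]
    constructor
    · intro h
      ext (x | b)
      · rw [blockDesign_mulVec_inl, ← blockDesign_mulVec_inl (φ ∘ bl), h]
        rfl
      · rw [← hinr, h]
        rfl
    · intro h
      ext (x | b)
      · rw [blockDesign_mulVec_inl, ← blockDesign_mulVec_inl bl, h]
        rfl
      · by_cases hb : ∃ b', Sym2.map φ b' = b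
        · obtain ⟨b', rfl⟩ := hb
          rw [hinr, h]
          rfl
        · rw [blockDesign_mulVec_inr, Finset.filter_false_of_mem, Finset.sum_empty, Pi.zero_apply]
          intro e _ he
          exact hb ⟨e.1.map bl, by rw [Sym2.map_map, he]⟩
  have h2 : SwapEqs (φ ∘ bl) p ↔ SwapEqs bl p := by
    simp only [SwapEqs, Function.comp_apply, hφ.eq_iff]
  simp only [blockSolutions, Set.mem_ofPred_eq, h1, h2]

/-- The map of edges induced by an injective map of vertices. -/
def Edge.map {V W : Type*} (f : V → W) (hf : Function.Injective f) (e : Edge V) : Edge W :=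
  ⟨e.1.map f, fun h => e.2 ((Sym2.isDiag_map hf).mp h)⟩

theorem Edge.map_mk {V W : Type*} (f : V → W) (hf : Function.Injective f) (a b : V) (h : a ≠ b) :
    Edge.map f hf (Edge.mk a b h) = Edge.mk (f a) (f b) (hf.ne h) := rfl

/-- The bijection of edges induced by a bijection of vertices. -/
def edgeCongr {V W : Type*} (e : V ≃ W) : Edge V ≃ Edge W where
  toFun := Edge.map e e.injective
  invFun := Edge.map e.symm e.symm.injective
  left_inv x := Subtype.ext (by simp [Edge.map, Sym2.map_map])
  right_inv x := Subtype.ext (by simp [Edge.map, Sym2.map_map])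

theorem edgeCongr_mk {V W : Type*} (e : V ≃ W) (a b : V) (h : a ≠ b) :
    edgeCongr e (Edge.mk a b h) = Edge.mk (e a) (e b) (e.injective.ne h) := rfl

theorem mem_blockSolutions_comp_equiv {V W I : Type*} [DecidableEq V] [DecidableEq W]
    [DecidableEq I] [Fintype V] [Fintype W] (e : V ≃ W) (bl : W → I) (u p : Edge W → ℂ) :
    p ∘ edgeCongr e ∈ blockSolutions (bl ∘ e) (u ∘ edgeCongr e) ↔ p ∈ blockSolutions bl u := by
  have h1 : ∀ v : Edge W → ℂ, (∀ x, (blockDesign (bl ∘ e) *ᵥ (v ∘ edgeCongr e)) (Sum.inl x) =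
      (blockDesign bl *ᵥ v) (Sum.inl (e x))) ∧
      ∀ b, (blockDesign (bl ∘ e) *ᵥ (v ∘ edgeCongr e)) (Sum.inr b) =
      (blockDesign bl *ᵥ v) (Sum.inr b) := by
    intro v
    constructor
    · intro x
      simp only [blockDesign_mulVec_inl, Finset.sum_filter]
      rw [← (edgeCongr e).sum_comp]
      refine Finset.sum_congr rfl fun y _ => ?_
      obtain ⟨a, b, hab, rfl⟩ := y.exists_eq_mk
      rw [Function.comp_apply, edgeCongr_mk]
      simp [Edge.mk]
    · intro x
      simp only [blockDesign_mulVec_inr, Finset.sum_filter]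
      rw [← (edgeCongr e).sum_comp]
      refine Finset.sum_congr rfl fun y _ => ?_
      obtain ⟨a, b, hab, rfl⟩ := y.exists_eq_mk
      rw [Function.comp_apply, edgeCongr_mk]
      exact if_congr Iff.rfl rfl rfl
  have hc : ∀ a b, edgeCoord (p ∘ edgeCongr e) a b = edgeCoord p (e a) (e b) := by
    intro a b
    by_cases h : a = b
    · simp [edgeCoord, h]
    · rw [edgeCoord_of_ne _ h, edgeCoord_of_ne _ (e.injective.ne h)]
      rfl
  have h2 : blockDesign (bl ∘ e) *ᵥ (p ∘ edgeCongr e - u ∘ edgeCongr e) = 0 ↔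
      blockDesign bl *ᵥ (p - u) = 0 := by
    have := h1 (p - u)
    rw [show (p - u) ∘ edgeCongr e = p ∘ edgeCongr e - u ∘ edgeCongr e from rfl] at this
    constructor
    · intro h
      rw [h] at this
      ext (x | b)
      · rw [← e.apply_symm_apply x, ← this.1]
        rfl
      · rw [← this.2]
        rfl
    · intro h
      rw [h] at this
      ext (x | b)
      · rw [this.1]
        rfl
      · rw [this.2]
        rfl
  have h3 : SwapEqs (bl ∘ e) (p ∘ edgeCongr e) ↔ SwapEqs bl p := by
    simp only [SwapEqs, hc, Function.comp_apply]
    constructor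
    · intro h t u w w'
      have := h (e.symm t) (e.symm u) (e.symm w) (e.symm w')
      simpa using this
    · intro h t u w w'
      have := h (e t) (e u) (e w) (e w')
      simpa using this
  simp only [blockSolutions, Set.mem_ofPred_eq, h2, h3]

theorem IsGenericCount.comp_equiv {V W I : Type*} [DecidableEq V] [DecidableEq W]
    [DecidableEq I] [Fintype V] [Fintype W] (e : V ≃ W) {bl : W → I} {d : ℕ}
    (hd : IsGenericCount (blockSolutions bl) d) :
    IsGenericCount (blockSolutions (bl ∘ e)) d := by
  obtain ⟨f, hf0, hf⟩ := hd
  refine ⟨rename (edgeCongr e).symm f, fun h => hf0 ?_, fun u hu => ?_⟩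
  · exact rename_injective _ (edgeCongr e).symm.injective (by rw [h, map_zero])
  · rw [eval_rename] at hu
    rw [← hf _ hu, ← ((edgeCongr e).arrowCongr (Equiv.refl ℂ)).symm.injective.encard_image]
    congr 1
    ext p
    have h : ∀ v : Edge V → ℂ, v = (v ∘ (edgeCongr e).symm) ∘ edgeCongr e := fun v => by
      ext; simp
    constructor
    · intro hp
      refine ⟨p ∘ (edgeCongr e).symm, ?_, (h p).symm⟩
      rw [← mem_blockSolutions_comp_equiv e, ← h, ← h]
      exact hp
    · rintro ⟨q, hq, rfl⟩
      rw [← mem_blockSolutions_comp_equiv e, ← h] at hq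
      exact hq

end Relabel

/-! ### Adding a vertex -/

section AddVertex

open Matrix

variable {V I : Type*}

/-- The edges of `Option V` are the edges of `V` and the edges from the new vertex `none`. -/
noncomputable def edgeOptionEquiv (V : Type*) : Edge V ⊕ V ≃ Edge (Option V) :=
  Equiv.ofBijective
    (Sum.elim (Edge.map some (Option.some_injective V))
      fun y => Edge.mk none (some y) (Option.some_ne_none y).symm) (by
    constructor
    · rintro (e | y) (e' | y') h
      · exact congrArg Sum.inl (Subtype.ext
          (Sym2.map.injective (Option.some_injective V) (congrArg Subtype.val h)))
      · obtain ⟨a, b, hab, rfl⟩ := e.exists_eq_mk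
        have := congrArg Subtype.val h
        simp [Edge.map, Edge.mk] at this
      · obtain ⟨a, b, hab, rfl⟩ := e'.exists_eq_mk
        have := congrArg Subtype.val h
        simp [Edge.map, Edge.mk] at this
      · have := congrArg Subtype.val h
        simp [Edge.mk] at this
        rw [this]
    · intro e
      obtain ⟨a, b, hab, rfl⟩ := e.exists_eq_mk
      rcases a with _ | a <;> rcases b with _ | b
      · exact absurd rfl hab
      · exact ⟨Sum.inr b, rfl⟩
      · exact ⟨Sum.inr a, Edge.mk_comm _ _ hab.symm⟩
      · exact ⟨Sum.inl (Edge.mk a b fun h => hab (congrArg some h)), rfl⟩)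

/-- The point on the edges of `Option V` given by `p` on the edges of `V` and by `q` on the edges
from the new vertex. -/
noncomputable def glue (p : Edge V → ℂ) (q : V → ℂ) : Edge (Option V) → ℂ :=
  fun e => Sum.elim p q ((edgeOptionEquiv V).symm e)

theorem glue_mk_some (p : Edge V → ℂ) (q : V → ℂ) (a b : V) (h : a ≠ b) (h' : some a ≠ some b) :
    glue p q (Edge.mk (some a) (some b) h') = p (Edge.mk a b h) := by
  have : Edge.mk (some a) (some b) h' = edgeOptionEquiv V (Sum.inl (Edge.mk a b h)) := rfl
  rw [glue, this, Equiv.symm_apply_apply, Sum.elim_inl]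

theorem glue_mk_none (p : Edge V → ℂ) (q : V → ℂ) (b : V) (h : none ≠ some b) :
    glue p q (Edge.mk none (some b) h) = q b := by
  have : Edge.mk none (some b) h = edgeOptionEquiv V (Sum.inr b) := rfl
  rw [glue, this, Equiv.symm_apply_apply, Sum.elim_inr]

theorem glue_sub (p p' : Edge V → ℂ) (q q' : V → ℂ) :
    glue p q - glue p' q' = glue (p - p') (q - q') := by
  ext e
  simp only [glue, Pi.sub_apply]
  rcases (edgeOptionEquiv V).symm e with e | e <;> rfl

theorem glue_left_injective (q : V → ℂ) : Function.Injective fun p : Edge V → ℂ => glue p q := by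
  intro p p' h
  ext e
  obtain ⟨a, b, hab, rfl⟩ := e.exists_eq_mk
  have h' : some a ≠ some b := fun h => hab (Option.some_injective V h)
  rw [← glue_mk_some p q a b hab h', ← glue_mk_some p' q a b hab h']
  exact congrFun h _

theorem dotProduct_glue [Fintype V] [DecidableEq V] (v : Edge (Option V) → ℂ) (p : Edge V → ℂ)
    (q : V → ℂ) : v ⬝ᵥ glue p q =
      ∑ e, v (edgeOptionEquiv V (Sum.inl e)) * p e +
        ∑ y, v (edgeOptionEquiv V (Sum.inr y)) * q y := by
  rw [dotProduct, ← (edgeOptionEquiv V).sum_comp, Fintype.sum_sum_type]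
  simp [glue]

variable [DecidableEq V]

theorem edgeCoord_glue_some (p : Edge V → ℂ) (q : V → ℂ) (a b : V) :
    edgeCoord (glue p q) (some a) (some b) = edgeCoord p a b := by
  by_cases h : a = b
  · simp [edgeCoord, h]
  · have h' : some a ≠ some b := fun h' => h (Option.some_injective V h')
    rw [edgeCoord_of_ne _ h, edgeCoord_of_ne _ h', glue_mk_some _ _ _ _ h]

theorem edgeCoord_glue_none (p : Edge V → ℂ) (q : V → ℂ) (b : V) :
    edgeCoord (glue p q) none (some b) = q b := by
  rw [edgeCoord_of_ne _ (Option.some_ne_none b).symm, glue_mk_none]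

theorem edgeCoord_glue_none' (p : Edge V → ℂ) (q : V → ℂ) (b : V) :
    edgeCoord (glue p q) (some b) none = q b := by
  rw [edgeCoord_comm, edgeCoord_glue_none]

variable [DecidableEq I] [Fintype V]

/-- The block map on `Option V` that puts the new vertex into the block `i₀`. -/
def addBlock (bl : V → I) (i₀ : I) : Option V → I := fun o => o.elim i₀ bl

theorem blockDesign_mulVec_glue_zero {bl : V → I} (i₀ : I) {v : Edge V → ℂ}
    (hv : blockDesign bl *ᵥ v = 0) : blockDesign (addBlock bl i₀) *ᵥ glue v 0 = 0 := by
  ext r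
  change (fun e => blockDesign (addBlock bl i₀) r e) ⬝ᵥ glue v 0 = 0
  rw [dotProduct_glue]
  simp only [Pi.zero_apply, mul_zero, Finset.sum_const_zero, add_zero]
  rcases r with (_ | x) | b
  · refine Finset.sum_eq_zero fun e _ => ?_
    obtain ⟨a, b, hab, rfl⟩ := e.exists_eq_mk
    simp [blockDesign, edgeOptionEquiv, Edge.map, Edge.mk]
  · refine Eq.trans ?_ (congrFun hv (Sum.inl x))
    refine Finset.sum_congr rfl fun e _ => ?_
    obtain ⟨a, b, hab, rfl⟩ := e.exists_eq_mk
    simp [blockDesign, edgeOptionEquiv, Edge.map, Edge.mk]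
  · refine Eq.trans ?_ (congrFun hv (Sum.inr b))
    refine Finset.sum_congr rfl fun e _ => ?_
    obtain ⟨a, b, hab, rfl⟩ := e.exists_eq_mk
    exact congrArg (· * _) (if_congr Iff.rfl rfl rfl)

/-- The label of the free parameter on which the edge from the new vertex to `y` depends. All `y`
such that `i₀` and the block of `y` already span an edge share the parameter of the new vertex;
otherwise the parameter belongs to the new pair of blocks. -/
def newParam (bl : V → I) (i₀ : I) (y : V) : Option I :=
  if ∃ a b, a ≠ b ∧ bl a = i₀ ∧ bl b = bl y then none else some (bl y)

theorem newParam_congr {bl : V → I} {i₀ : I} {y y' : V} (h : bl y = bl y') :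
    newParam bl i₀ y = newParam bl i₀ y' := by
  simp only [newParam, h]

theorem newParam_eq_none {bl : V → I} {i₀ : I} {a y : V} (ha : bl a = i₀) (hay : a ≠ y) :
    newParam bl i₀ y = none :=
  if_pos ⟨a, y, hay, ha, rfl⟩

/-- The logarithm of the coordinate of the edge from the new vertex to `y`, up to its free
parameter. -/
noncomputable def newLog (bl : V → I) (i₀ : I) (y : V) : (V ⊕ Sym2 I → ℂ) →L[ℂ] ℂ :=
  ContinuousLinearMap.proj (R := ℂ) (φ := fun _ : V ⊕ Sym2 I => ℂ) (Sum.inl y) +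
    ContinuousLinearMap.proj (R := ℂ) (φ := fun _ : V ⊕ Sym2 I => ℂ) (Sum.inr s(i₀, bl y))

/-- The solutions near those of the smaller model: torus points of the smaller model, and on the
new edges the products of the free parameters `s` and the exponentials of `newLog`. -/
noncomputable def newFamily [Fintype I] (bl : V → I) (i₀ : I)
    (z : (V ⊕ Sym2 I → ℂ) × (Option I → ℂ)) : Edge (Option V) → ℂ :=
  glue (expPoint (blockDesign bl) z.1)
    fun y => z.2 (newParam bl i₀ y) * Complex.exp (newLog bl i₀ y z.1)

/-- A potential that vanishes on the edges of the small model is constant on the new edges that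
share a free parameter. The third vertex is needed to see that it is constant on blocks. -/
theorem newLog_eq_of_ker [Fintype I] {bl : V → I} {i₀ : I}
    (hthird : ∀ a b : V, ∃ w, w ≠ a ∧ w ≠ b)
    {η : V ⊕ Sym2 I → ℂ} (hη : (blockDesign bl)ᵀ *ᵥ η = 0) {y y' : V}
    (hg : newParam bl i₀ y = newParam bl i₀ y') : newLog bl i₀ y η = newLog bl i₀ y' η := by
  have hedge : ∀ a b, a ≠ b → η (Sum.inl a) + η (Sum.inl b) + η (Sum.inr s(bl a, bl b)) = 0 := by
    intro a b h
    rw [← blockDesign_transpose_mulVec bl η a b h, hη, Pi.zero_apply]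
  have hconst : ∀ a b, bl a = bl b → η (Sum.inl a) = η (Sum.inl b) := by
    intro a b hab
    obtain ⟨w, h1, h2⟩ := hthird a b
    have e1 := hedge a w h1.symm
    have e2 := hedge b w h2.symm
    rw [hab] at e1
    linear_combination e1 - e2
  have hnone : ∀ y, newParam bl i₀ y = none → ∃ a, bl a = i₀ ∧
      newLog bl i₀ y η = - η (Sum.inl a) := by
    intro y hy
    unfold newParam at hy
    split_ifs at hy with h
    obtain ⟨a, b, hab, ha, hb⟩ := h
    refine ⟨a, ha, ?_⟩
    have e1 := hedge a b hab
    rw [hconst b y hb, ha, hb] at e1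
    simp only [newLog, _root_.add_apply, ContinuousLinearMap.proj_apply]
    linear_combination e1
  cases hy : newParam bl i₀ y with
  | none =>
    obtain ⟨a, ha, h1⟩ := hnone y hy
    obtain ⟨a', ha', h2⟩ := hnone y' (hg ▸ hy)
    rw [h1, h2, hconst a a' (ha.trans ha'.symm)]
  | some i =>
    have hi : ∀ y, newParam bl i₀ y = some i → bl y = i := by
      intro y hy
      unfold newParam at hy
      split_ifs at hy
      exact Option.some_injective _ hy
    have hb : bl y = bl y' := (hi y hy).trans (hi y' (hg ▸ hy)).symm
    simp only [newLog, _root_.add_apply, ContinuousLinearMap.proj_apply, hb, hconst y y' hb]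

theorem swapEqs_newFamily [Fintype I] (bl : V → I) (i₀ : I)
    (z : (V ⊕ Sym2 I → ℂ) × (Option I → ℂ)) : SwapEqs (addBlock bl i₀) (newFamily bl i₀ z) := by
  have hc : ∀ a b, a ≠ b → edgeCoord (expPoint (blockDesign bl) z.1) a b =
      Complex.exp (z.1 (Sum.inl a)) * Complex.exp (z.1 (Sum.inl b)) *
        Complex.exp (z.1 (Sum.inr s(bl a, bl b))) := by
    intro a b h
    rw [edgeCoord_of_ne _ h, expPoint, blockDesign_transpose_mulVec, Complex.exp_add,
      Complex.exp_add]
  have hq : ∀ y, Complex.exp (newLog bl i₀ y z.1) =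
      Complex.exp (z.1 (Sum.inl y)) * Complex.exp (z.1 (Sum.inr s(i₀, bl y))) := fun y =>
    Complex.exp_add _ _
  have hsome : ∀ {a b : V}, some a ≠ some b → a ≠ b := fun h h' => h (congrArg some h')
  rintro (_ | t) (_ | u) (_ | w) (_ | w') hbl h1 h2 h3 h4
  all_goals first
    | exact absurd rfl h1
    | exact absurd rfl h2
    | exact absurd rfl h3
    | exact absurd rfl h4
    | skip
  all_goals simp only [newFamily, edgeCoord_glue_some, edgeCoord_glue_none, edgeCoord_glue_none']
  · ring
  · have hu : bl u = i₀ := hbl.symm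
    rw [newParam_eq_none hu (hsome h2).symm, newParam_eq_none hu (hsome h4).symm,
      hc _ _ (hsome h2).symm, hc _ _ (hsome h4).symm, hq, hq, hu]
    ring
  · have ht : bl t = i₀ := hbl
    rw [newParam_eq_none ht (hsome h1).symm, newParam_eq_none ht (hsome h3).symm,
      hc _ _ (hsome h1).symm, hc _ _ (hsome h3).symm, hq, hq, ht]
    ring
  · have htu : bl t = bl u := hbl
    rw [newParam_congr htu, hc _ _ (hsome h3).symm, hc _ _ (hsome h4).symm, hq, hq, htu]
    ring
  · have htu : bl t = bl u := hbl
    rw [newParam_congr htu, hc _ _ (hsome h1).symm, hc _ _ (hsome h2).symm, hq, hq, htu]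
    ring
  · exact swapEqs_expPoint bl z.1 t u w w' hbl (hsome h1) (hsome h2) (hsome h3) (hsome h4)

/-- The derivative of `newFamily` at a point with vanishing free parameters. -/
noncomputable def newFamilyDeriv [Fintype I] (bl : V → I) (i₀ : I) (η : V ⊕ Sym2 I → ℂ) :
    (V ⊕ Sym2 I → ℂ) × (Option I → ℂ) →L[ℂ] (Edge (Option V) → ℂ) :=
  ContinuousLinearMap.pi fun e => Sum.elim
    (fun e => (expPoint (blockDesign bl) η e •
      (ContinuousLinearMap.proj (R := ℂ) (φ := fun _ : Edge V => ℂ) e).comp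
        (blockDesign bl)ᵀ.mulVecLin.toContinuousLinearMap).comp (ContinuousLinearMap.fst ℂ _ _))
    (fun y => Complex.exp (newLog bl i₀ y η) •
      (ContinuousLinearMap.proj (R := ℂ) (φ := fun _ : Option I => ℂ) (newParam bl i₀ y)).comp
        (ContinuousLinearMap.snd ℂ _ _)) ((edgeOptionEquiv V).symm e)

theorem newFamilyDeriv_apply [Fintype I] (bl : V → I) (i₀ : I) (η : V ⊕ Sym2 I → ℂ)
    (v : (V ⊕ Sym2 I → ℂ) × (Option I → ℂ)) : newFamilyDeriv bl i₀ η v =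
      glue (expPoint (blockDesign bl) η * ((blockDesign bl)ᵀ *ᵥ v.1))
        fun y => Complex.exp (newLog bl i₀ y η) * v.2 (newParam bl i₀ y) := by
  ext e
  simp only [newFamilyDeriv, glue, ContinuousLinearMap.pi_apply]
  rcases (edgeOptionEquiv V).symm e with e | y <;> rfl

theorem hasStrictFDerivAt_newFamily [Fintype I] (bl : V → I) (i₀ : I) (η : V ⊕ Sym2 I → ℂ) :
    HasStrictFDerivAt (newFamily bl i₀) (newFamilyDeriv bl i₀ η) (η, 0) := by
  rw [hasStrictFDerivAt_pi']
  intro e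
  change HasStrictFDerivAt (fun z : (V ⊕ Sym2 I → ℂ) × (Option I → ℂ) => Sum.elim
    (expPoint (blockDesign bl) z.1)
    (fun y => z.2 (newParam bl i₀ y) * Complex.exp (newLog bl i₀ y z.1))
    ((edgeOptionEquiv V).symm e)) (Sum.elim _ _ ((edgeOptionEquiv V).symm e)) (η, 0)
  rcases (edgeOptionEquiv V).symm e with e | y
  · exact HasStrictFDerivAt.comp (η, 0) (f := Prod.fst)
      (hasStrictFDerivAt_expPoint (blockDesign bl) η e) hasStrictFDerivAt_fst
  · have h1 := ((ContinuousLinearMap.proj (R := ℂ) (φ := fun _ : Option I => ℂ)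
      (newParam bl i₀ y)).comp (ContinuousLinearMap.snd ℂ (V ⊕ Sym2 I → ℂ)
        (Option I → ℂ))).hasStrictFDerivAt (x := (η, 0))
    have h2 := ((newLog bl i₀ y).comp (ContinuousLinearMap.fst ℂ (V ⊕ Sym2 I → ℂ)
      (Option I → ℂ))).hasStrictFDerivAt (x := (η, 0)) |>.cexp
    refine (h1.mul h2).congr_fderiv (ContinuousLinearMap.ext fun v => ?_)
    -- The first summand of the product rule vanishes since the parameters are zero.
    change (0 : ℂ) * _ + _ = _
    rw [zero_mul, zero_add]
    rfl

/-- The tangent space of the family at a point with vanishing free parameters is transverse to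
`ker A`, provided that the point of the smaller model is nondegenerate and that, for each free
parameter, the coefficients of the new edges do not sum to zero. -/
theorem range_newFamilyDeriv_sup_ker [Fintype I] {bl : V → I} {i₀ : I} {η : V ⊕ Sym2 I → ℂ}
    (hthird : ∀ a b : V, ∃ w, w ≠ a ∧ w ≠ b)
    (hη : Nondegenerate (blockDesign bl) (expPoint (blockDesign bl) η))
    (hsum : ∀ y₀, ∑ y ∈ Finset.univ.filter fun y => newParam bl i₀ y = newParam bl i₀ y₀,
      Complex.exp (newLog bl i₀ y η) ≠ 0) :
    LinearMap.range (newFamilyDeriv bl i₀ η :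
        (V ⊕ Sym2 I → ℂ) × (Option I → ℂ) →ₗ[ℂ] (Edge (Option V) → ℂ)) ⊔
      LinearMap.ker (blockDesign (addBlock bl i₀)).mulVecLin = ⊤ := by
  classical
  refine sup_ker_eq_top_of_dotProduct _ _ fun θ hθ => ?_
  set lam := (blockDesign (addBlock bl i₀))ᵀ *ᵥ θ
  have hθ' : ∀ v : (V ⊕ Sym2 I → ℂ) × (Option I → ℂ), lam ⬝ᵥ glue
      (expPoint (blockDesign bl) η * ((blockDesign bl)ᵀ *ᵥ v.1))
      (fun y => Complex.exp (newLog bl i₀ y η) * v.2 (newParam bl i₀ y)) = 0 := by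
    intro v
    rw [← newFamilyDeriv_apply]
    exact hθ _ ⟨v, rfl⟩
  let θ' : V ⊕ Sym2 I → ℂ := Sum.elim (fun x => θ (Sum.inl (some x))) fun b => θ (Sum.inr b)
  have hinner : ∀ e, lam (edgeOptionEquiv V (Sum.inl e)) = ((blockDesign bl)ᵀ *ᵥ θ') e := by
    intro e
    obtain ⟨a, b, hab, rfl⟩ := e.exists_eq_mk
    rw [blockDesign_transpose_mulVec]
    exact blockDesign_transpose_mulVec (addBlock bl i₀) θ (some a) (some b)
      fun h => hab (Option.some_injective V h)
  have houter : ∀ y, lam (edgeOptionEquiv V (Sum.inr y)) =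
      θ (Sum.inl none) + newLog bl i₀ y θ' := by
    intro y
    refine (blockDesign_transpose_mulVec (addBlock bl i₀) θ none (some y)
      (Option.some_ne_none y).symm).trans ?_
    rw [add_assoc]
    rfl
  have hzero : (blockDesign bl)ᵀ *ᵥ θ' = 0 := by
    refine hη.eq_zero_of_dotProduct fun η' => ?_
    have h := hθ' (η', 0)
    rw [dotProduct_glue] at h
    simpa [hinner, dotProduct] using h
  have houter0 : ∀ y, lam (edgeOptionEquiv V (Sum.inr y)) = 0 := by
    intro y₀
    have h := hθ' (0, Pi.single (newParam bl i₀ y₀) 1)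
    rw [dotProduct_glue] at h
    simp only [Pi.mul_apply, mulVec_zero, Pi.zero_apply, mul_zero, Finset.sum_const_zero, zero_add,
      Pi.single_apply, mul_ite, mul_one] at h
    rw [← Finset.sum_filter] at h
    have h' : ∀ y ∈ Finset.univ.filter fun y => newParam bl i₀ y = newParam bl i₀ y₀,
        lam (edgeOptionEquiv V (Sum.inr y)) * Complex.exp (newLog bl i₀ y η) =
        lam (edgeOptionEquiv V (Sum.inr y₀)) * Complex.exp (newLog bl i₀ y η) := by
      intro y hy
      rw [houter, houter, newLog_eq_of_ker hthird hzero (Finset.mem_filter.mp hy).2]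
    rw [Finset.sum_congr rfl h', ← Finset.mul_sum] at h
    exact (mul_eq_zero.mp h).resolve_right (hsum y₀)
  ext e
  obtain ⟨e | y, rfl⟩ := (edgeOptionEquiv V).surjective e
  · rw [hinner, hzero]
    rfl
  · exact houter0 y

/-- Adding a vertex to a model with at least three vertices does not decrease the generic number
of solutions. -/
theorem IsGenericCount.le_addBlock_of_third [Fintype I] {bl : V → I} {i₀ : I}
    (hthird : ∀ a b : V, ∃ w, w ≠ a ∧ w ≠ b) {d d' : ℕ}
    (hd : IsGenericCount (blockSolutions bl) d)
    (hd' : IsGenericCount (blockSolutions (addBlock bl i₀)) d') : d ≤ d' := by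
  obtain ⟨f, hf0, hf⟩ := hd
  obtain ⟨f', hf'0, hf'⟩ := hd'
  set A := blockDesign bl
  set A' := blockDesign (addBlock bl i₀)
  have hsum : ∀ᵐ u : Edge V → ℂ, ∀ y₀, ∀ η, A *ᵥ (expPoint A η - u) = 0 →
      ∑ y ∈ Finset.univ.filter fun y => newParam bl i₀ y = newParam bl i₀ y₀,
        Complex.exp (newLog bl i₀ y η) ≠ 0 := by
    refine ae_all_iff.mpr fun y₀ => ?_
    refine ae_sum_exp_ne_zero A _ (newLog bl i₀) (y₀ := y₀) (by simp)
      (Pi.single (Sum.inl y₀) 1) ?_ ?_ ?_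
    · simp [newLog]
    · intro y _ hy
      simp [newLog, hy]
    · intro κ hκ y hy
      exact newLog_eq_of_ker hthird hκ (Finset.mem_filter.mp hy).2
  obtain ⟨u, ⟨⟨hu, huexp⟩, hund⟩, husum⟩ := (((ae_eval_ne_zero f hf0).and
    (ae_blockSolutions_expPoint bl)).and (ae_nondegenerate A)).and hsum |>.exists
  obtain ⟨q, hqinj, hq⟩ := natCast_le_encard_iff.mp (hf u hu).ge
  have hginj : Function.Injective fun i => glue (q i) 0 := (glue_left_injective 0).comp hqinj
  obtain ⟨U, hU, hUdisj⟩ := (Set.finite_range fun i => glue (q i) 0).t2_separation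
  -- Each solution of the smaller model, extended by zero, persists near itself.
  have hev : ∀ i, ∀ᶠ u' in nhds (glue u 0), ∃ p, p ∈ U (glue (q i) 0) ∧
      p ∈ blockSolutions (addBlock bl i₀) u' := by
    intro i
    obtain ⟨η, hη⟩ := huexp (q i) (hq i)
    have hAη : A *ᵥ (expPoint A η - u) = 0 := hη ▸ (hq i).1
    have h0 : newFamily bl i₀ (η, 0) = glue (q i) 0 := by
      rw [hη]
      unfold newFamily
      congr 1
      ext y
      simp
    have h1 := eventually_exists_solution A' (hasStrictFDerivAt_newFamily bl i₀ η)
      (range_newFamilyDeriv_sup_ker hthird (hund η hAη) fun y₀ => husum y₀ η hAη)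
      (u₀ := glue u 0) (O := U (glue (q i) 0))
      (by
        rw [h0, glue_sub, sub_zero]
        exact blockDesign_mulVec_glue_zero i₀ (hq i).1)
      (by
        rw [h0]
        exact (hU _).2.mem_nhds (hU _).1)
    filter_upwards [h1] with u' hu'
    obtain ⟨z, hz, hz'⟩ := hu'
    exact ⟨_, hz, hz', swapEqs_newFamily bl i₀ z⟩
  obtain ⟨u', hu', hex⟩ := exists_and_of_ae_of_eventually (ae_eval_ne_zero f' hf'0)
    (Filter.eventually_all.mpr hev)
  choose p hpU hp using hex
  have hle : (d : ℕ∞) ≤ (blockSolutions (addBlock bl i₀) u').encard := by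
    refine natCast_le_encard_iff.mpr ⟨p, fun i j hij => ?_, hp⟩
    by_contra hne
    exact Set.disjoint_left.mp (hUdisj ⟨i, rfl⟩ ⟨j, rfl⟩ (hginj.ne hne)) (hpU i) (hij ▸ hpU j)
  rw [hf' u' hu'] at hle
  exact_mod_cast hle

theorem IsGenericCount.le_addBlock [Fintype I] {bl : V → I} {i₀ : I} {d d' : ℕ}
    (hd : IsGenericCount (blockSolutions bl) d)
    (hd' : IsGenericCount (blockSolutions (addBlock bl i₀)) d') : d ≤ d' := by
  by_cases hthird : ∀ a b : V, ∃ w, w ≠ a ∧ w ≠ b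
  · exact hd.le_addBlock_of_third hthird hd'
  · have := subsingleton_edge_of_not_third hthird
    exact hd.le_one.trans hd'.one_le

end AddVertex

/-- Restricting a block model to a subset of the vertices does not increase the generic number of
solutions. -/
theorem IsGenericCount.le_of_injective {I : Type*} [DecidableEq I] [Fintype I] (n : ℕ) :
    ∀ {V W : Type} [DecidableEq V] [DecidableEq W] [Fintype V] [Fintype W] {f : V → W}
      {bl : W → I} {d d' : ℕ}, Function.Injective f → Fintype.card W = Fintype.card V + n →
      IsGenericCount (blockSolutions (bl ∘ f)) d → IsGenericCount (blockSolutions bl) d' →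
      d ≤ d' := by
  induction n with
  | zero =>
    intro V W _ _ _ _ f bl d d' hf hcard hd hd'
    let e := Equiv.ofBijective f ((Fintype.bijective_iff_injective_and_card f).mpr
      ⟨hf, by rw [hcard, add_zero]⟩)
    exact ((hd'.comp_equiv e).eq hd).ge
  | succ n ih =>
    intro V W _ _ _ _ f bl d d' hf hcard hd hd'
    have hns : ¬ Function.Surjective f := fun hs => by
      have := Fintype.card_le_of_surjective f hs
      omega
    obtain ⟨x, hx⟩ := not_forall.mp hns
    have hx' : ∀ v, f v ≠ x := fun v hv => hx ⟨v, hv⟩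
    have hinj : Function.Injective fun o : Option V => o.elim x f := by
      rintro (_ | v) (_ | v') h
      · rfl
      · exact absurd h.symm (hx' v')
      · exact absurd h (hx' v)
      · exact congrArg some (hf h)
    have hbl : bl ∘ (fun o : Option V => o.elim x f) = addBlock (bl ∘ f) (bl x) := by
      ext (_ | v) <;> rfl
    obtain ⟨d'', hd''⟩ := exists_isGenericCount_blockSolutions
      (bl ∘ fun o : Option V => o.elim x f)
    refine le_trans (hd.le_addBlock (hbl ▸ hd'')) (ih hinj ?_ hd'' hd')
    rw [Fintype.card_option]
    omega

/-! ### The likelihood equations -/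

theorem swapEqs_iff {k : ℕ} {n : Fin k → ℕ} (p : Dyad n → ℂ) :
    SwapEqs (Sigma.fst : Vertex n → Fin k) p ↔
      WithinBlockEqs p ∧ ThreeOneEqs p ∧ TwoTwoEqs p ∧ TwoOneOneEqs p := by
  have hcc : ∀ a b, coord p a b = coord p b a := edgeCoord_comm p
  have hne : ∀ {i j : Fin k} (x : Fin (n i)) (y : Fin (n j)), i ≠ j →
      (⟨i, x⟩ : Vertex n) ≠ ⟨j, y⟩ := fun x y h h' => h (congrArg Sigma.fst h')
  have hne' : ∀ {i : Fin k} {x y : Fin (n i)}, x ≠ y → (⟨i, x⟩ : Vertex n) ≠ ⟨i, y⟩ :=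
    fun h h' => h (eq_of_heq (Sigma.mk.inj h').2)
  constructor
  · intro hs
    have hs' : ∀ t u w w' : Vertex n, t.1 = u.1 → w ≠ t → w ≠ u → w' ≠ t → w' ≠ u →
        coord p t w * coord p u w' = coord p t w' * coord p u w := hs
    refine ⟨?_, ?_, ?_, ?_⟩
    · intro i t u v w htu htv htw huv huw hvw
      have := hs' ⟨i, t⟩ ⟨i, w⟩ ⟨i, u⟩ ⟨i, v⟩ rfl (hne' htu.symm) (hne' huw) (hne' htv.symm)
        (hne' hvw)
      rw [hcc ⟨i, v⟩, hcc ⟨i, u⟩ ⟨i, w⟩, this, sub_self]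
    · intro i j hij t u v w htu htv huv
      have := hs' ⟨i, t⟩ ⟨i, v⟩ ⟨j, w⟩ ⟨i, u⟩ rfl (hne _ _ hij.symm) (hne _ _ hij.symm)
        (hne' htu.symm) (hne' huv)
      rw [hcc ⟨i, u⟩, this, sub_self]
    · intro i j hij t u v w htu hvw
      have := hs' ⟨i, t⟩ ⟨i, u⟩ ⟨j, v⟩ ⟨j, w⟩ rfl (hne _ _ hij.symm) (hne _ _ hij.symm)
        (hne _ _ hij.symm) (hne _ _ hij.symm)
      rw [this, sub_self]
    · intro i j l hij hil hjl t u v w htu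
      have := hs' ⟨i, t⟩ ⟨i, u⟩ ⟨j, v⟩ ⟨l, w⟩ rfl (hne _ _ hij.symm) (hne _ _ hij.symm)
        (hne _ _ hil.symm) (hne _ _ hil.symm)
      rw [this, sub_self]
  · rintro ⟨h4, h31, h22, h211⟩
    rintro ⟨i, t⟩ ⟨_, u⟩ ⟨j, v⟩ ⟨l, w⟩ (rfl : i = _) h1 h2 h3 h4'
    change coord p _ _ * coord p _ _ = coord p _ _ * coord p _ _
    have hn : ∀ {i : Fin k} {x y : Fin (n i)}, (⟨i, x⟩ : Vertex n) ≠ ⟨i, y⟩ → x ≠ y :=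
      fun h h' => h (by rw [h'])
    by_cases htu : t = u
    · rw [htu, mul_comm]
    by_cases hj : j = i <;> by_cases hl : l = i
    · subst hj hl
      by_cases hvw : v = w
      · rw [hvw]
      have := h4 _ t v w u (hn h1).symm (hn h3).symm htu hvw (hn h2) (hn h4')
      rw [hcc ⟨l, w⟩, hcc ⟨l, v⟩ ⟨l, u⟩] at this
      exact sub_eq_zero.mp this
    · subst hj
      have := h31 _ l (Ne.symm hl) t v u w (hn h1).symm htu (hn h2)
      rw [hcc ⟨j, v⟩] at this
      exact (sub_eq_zero.mp this).symm
    · subst hl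
      have := h31 _ j (Ne.symm hj) t w u v (hn h3).symm htu (hn h4')
      rw [hcc ⟨l, w⟩] at this
      exact sub_eq_zero.mp this
    · by_cases hjl : j = l
      · subst hjl
        by_cases hvw : v = w
        · rw [hvw]
        exact sub_eq_zero.mp (h22 i j (Ne.symm hj) t u v w htu hvw)
      · exact sub_eq_zero.mp (h211 i j l (Ne.symm hj) (Ne.symm hl) hjl t u v w htu)

theorem likelihoodSolutions_eq {k : ℕ} (n : Fin k → ℕ) :
    likelihoodSolutions n = blockSolutions (Sigma.fst : Vertex n → Fin k) := by
  have h : designMatrix n = blockDesign (Sigma.fst : Vertex n → Fin k) := by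
    ext (x | b) e <;> rfl
  ext u p
  exact and_congr (by rw [h]) (swapEqs_iff p).symm

theorem isMLDegree_iff {k : ℕ} (n : Fin k → ℕ) (d : ℕ) :
    IsMLDegree n d ↔ IsGenericCount (blockSolutions (Sigma.fst : Vertex n → Fin k)) d := by
  rw [← likelihoodSolutions_eq]
  rfl

theorem isMLDegree_mlDegree {k : ℕ} (n : Fin k → ℕ) : IsMLDegree n (mlDegree n) := by
  obtain ⟨d, hd⟩ := exists_isGenericCount_blockSolutions (Sigma.fst : Vertex n → Fin k)
  rw [← isMLDegree_iff] at hd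
  rwa [hd.mlDegree_eq]

end BetaSBM

theorem mainTheorem4 (j k : ℕ) (m : Fin j → ℕ) (n : Fin k → ℕ)
    (hm : ∀ i, 1 ≤ m i) (hn : ∀ i, 1 ≤ n i)
    (hm2 : 2 ≤ ∑ i, m i) (hn2 : 2 ≤ ∑ i, n i)
    (hjk : j ≤ k) (hmn : ∀ i : Fin j, m i ≤ n (Fin.castLE hjk i)) :
    BetaSBM.IsMLDegree m (BetaSBM.mlDegree m) ∧
      BetaSBM.IsMLDegree n (BetaSBM.mlDegree n) ∧
      BetaSBM.mlDegree m ≤ BetaSBM.mlDegree n := by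
  have h1 := BetaSBM.isMLDegree_mlDegree m
  have h2 := BetaSBM.isMLDegree_mlDegree n
  refine ⟨h1, h2, ?_⟩
  rw [BetaSBM.isMLDegree_iff] at h1 h2
  let f : BetaSBM.Vertex m → BetaSBM.Vertex n := fun x =>
    ⟨Fin.castLE hjk x.1, Fin.castLE (hmn x.1) x.2⟩
  have hf : Function.Injective f := by
    rintro ⟨i, v⟩ ⟨i', v'⟩ h
    have h3 : i = i' := Fin.castLE_injective hjk (congrArg Sigma.fst h)
    subst h3
    have h4 : Fin.castLE (hmn i) v = Fin.castLE (hmn i) v' := eq_of_heq (Sigma.mk.inj h).2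
    rw [Fin.castLE_injective _ h4]
  have hbl : (Sigma.fst : BetaSBM.Vertex n → Fin k) ∘ f = Fin.castLE hjk ∘ Sigma.fst := rfl
  have h3 : BetaSBM.IsGenericCount (BetaSBM.blockSolutions
      ((Sigma.fst : BetaSBM.Vertex n → Fin k) ∘ f)) (BetaSBM.mlDegree m) := by
    rwa [hbl, BetaSBM.blockSolutions_comp_injective _ (Fin.castLE_injective hjk)]
  exact BetaSBM.IsGenericCount.le_of_injective
    (Fintype.card (BetaSBM.Vertex n) - Fintype.card (BetaSBM.Vertex m)) hf
    (Nat.add_sub_cancel' (Fintype.card_le_of_injective f hf)).symm h3 h2
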